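/- Let $\sigma(x)=\max\{0,x\}$, applied coordinatewise. A ReLU network of depth $L\ge 2$ is a function $T_L\circ\sigma\circ T_{L-1}\circ\cdots\circ\sigma\circ T_1$ with affine maps $T_l:\mathbb{R}^{N_{l-1}}\to\mathbb{R}^{N_l}$; its width is $\max\{N_1,\dots,N_{L-1}\}$ (hidden layers of size $0$ are allowed; such a network is constant). "A ReLU network with width $N$ and depth $L$" means a function representable with width at most $N$ and depth at most $L$. Let $d,j\ge 1$ be integers, $0<\delta<2^{-j}$, $0<\epsilon<1$, $M>0$, and let $\varphi:\mathbb{R}^d\to\mathbb{R}$ be continuous with compact support. Put $$C_\varphi:=\left|\{n\in\mathbb{Z}^d:\ \varphi(x-n)\ne 0\text{ for some }x\in[0,1)^d\}\right|,$$ $$\mathcal{S}_j(\varphi,M):=\Big\{\sum_{n\in\mathbb{Z}^d}c_n\varphi(2^j\,\cdot\,-n):\ c_n=0\text{ for all but finitely many }n,\ |c_n|<M\text{ for all }n\Big\},$$ $$Q(j,\delta,1):=[0,1)\setminus\bigcup_{k=1}^{2^j-1}(k2^{-j}-\delta,\,k2^{-j}),\qquad Q(j,\delta,d):=\{x\in\mathbb{R}^d:\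 x_i\in Q(j,\delta,1),\ 1\le i\le d\}.$$ Assume that there is a ReLU network $\phi_0:\mathbb{R}^d\to\mathbb{R}$ with width $N_\varphi(\epsilon)$ and depth $L_\varphi(\epsilon)$ such that $\|\varphi-\phi_0\|_\infty\le\epsilon\|\varphi\|_\infty$, where $\|\cdot\|_\infty$ is the norm of $L^\infty(\mathbb{R}^d)$. Then for every $g\in\mathcal{S}_j(\varphi,M)$ and all integers $r,s,\tilde r,\tilde s\ge 1$ with $2(s+r)\ge dj$ and $\tilde r\tilde s\ge\lceil\log_2(1/\epsilon)\rceil+1$ there is a ReLU network $\phi:\mathbb{R}^d\to\mathbb{R}$ with width $C_\varphi\big(\max\{7d\tilde r2^r,N_\varphi(\epsilon)\}+4d\big)$ and depth $14\tilde s2^s+L_\varphi(\epsilon)$ such that $$|g(x)-\phi(x)|\le 3C_\varphi M\|\varphi\|_\infty\,\epsilon\qquad\text{for all }x\in Q(j,\delta,d).$$ -/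

import Mathlib

open MeasureTheory
open scoped ENNReal Matrix

noncomputable section

/-- The ReLU activation function `σ(x) = max {0, x}`. -/
def relu (x : ℝ) : ℝ := max 0 x

/-- Fully connected feed-forward ReLU networks with `m` inputs and `k` outputs, as lists of affine
layers `x ↦ A x + b`. The last layer is affine, every earlier layer is followed by the
activation function. -/
inductive ReLUNetwork : ℕ → ℕ → Type
  | output {m k : ℕ} (A : Matrix (Fin k) (Fin m) ℝ) (b : Fin k → ℝ) : ReLUNetwork m k
  | hidden {m n k : ℕ} (A : Matrix (Fin n) (Fin m) ℝ) (b : Fin n → ℝ)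
      (rest : ReLUNetwork n k) : ReLUNetwork m k

/-- The function `T_L ∘ σ ∘ T_{L-1} ∘ ⋯ ∘ σ ∘ T_1` computed by a network. -/
def ReLUNetwork.eval : {m k : ℕ} → ReLUNetwork m k → (Fin m → ℝ) → (Fin k → ℝ)
  | _, _, .output A b, x => A *ᵥ x + b
  | _, _, .hidden A b rest, x => rest.eval (fun i => relu ((A *ᵥ x + b) i))

/-- The depth `L` of a network: the number of its affine layers. -/
def ReLUNetwork.depth : {m k : ℕ} → ReLUNetwork m k → ℕ
  | _, _, .output _ _ => 1
  | _, _, .hidden _ _ rest => rest.depth + 1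

/-- The width `max {N_1, …, N_{L-1}}` of a network: the largest size of a hidden layer. -/
def ReLUNetwork.width : {m k : ℕ} → ReLUNetwork m k → ℕ
  | _, _, .output _ _ => 0
  | _, _, .hidden (n := n) _ _ rest => max n rest.width

/-- The set of functions `ℝ^d → ℝ` that are represented by a ReLU network (of depth at least `2`)
of width at most `N` and depth at most `L`. -/
def reluNN (d N L : ℕ) : Set ((Fin d → ℝ) → ℝ) :=
  {f | ∃ net : ReLUNetwork d 1, 2 ≤ net.depth ∧ net.depth ≤ L ∧ net.width ≤ N ∧
    ∀ x, f x = net.eval x 0}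

/-- `S_j(φ, M)`: the functions `∑ c_n φ(2^j x - n)` over `n ∈ ℤ^d`, with finitely many nonzero
coefficients, all of absolute value less than `M`. -/
def shiftInvariantSpace {d : ℕ} (φ : (Fin d → ℝ) → ℝ) (j : ℕ) (M : ℝ) :
    Set ((Fin d → ℝ) → ℝ) :=
  {g | ∃ c : (Fin d → ℤ) →₀ ℝ, (∀ n, |c n| < M) ∧
    ∀ x, g x = c.sum fun n a => a * φ (fun i => 2 ^ j * x i - (n i : ℝ))}

/-- `ℤ^d_φ`: the `n ∈ ℤ^d` such that `φ(x - n) ≠ 0` for some `x ∈ [0,1)^d`. -/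
def activeShifts {d : ℕ} (φ : (Fin d → ℝ) → ℝ) : Set (Fin d → ℤ) :=
  {n | ∃ x : Fin d → ℝ, (∀ i, x i ∈ Set.Ico (0 : ℝ) 1) ∧ φ (fun i => x i - (n i : ℝ)) ≠ 0}

/-- `ℤ^d_φ` is finite, so that its cardinality `C_φ` is meaningful. -/
theorem activeShifts_finite {d : ℕ} {φ : (Fin d → ℝ) → ℝ} (hφ : HasCompactSupport φ) :
    (activeShifts φ).Finite := by
  obtain ⟨R, hR⟩ := hφ.isCompact.isBounded.subset_closedBall (0 : Fin d → ℝ)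
  refine (Set.finite_Icc (fun _ => -(⌈R⌉ + 1) : Fin d → ℤ) (fun _ => ⌈R⌉ + 1)).subset ?_
  rintro n ⟨x, hx, hne⟩
  have h1 := hR (subset_tsupport φ hne)
  rw [mem_closedBall_zero_iff] at h1
  have h2 : ∀ i, -(⌈R⌉ + 1) ≤ n i ∧ n i ≤ ⌈R⌉ + 1 := by
    intro i
    have h3 := abs_le.1 ((norm_le_pi_norm _ i).trans h1)
    have h4 := hx i
    have h5 := Int.le_ceil R
    have h6 : (-(⌈R⌉ + 1) : ℝ) ≤ n i := by linarith [h3.1, h3.2, h4.1, h4.2]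
    have h7 : (n i : ℝ) ≤ ⌈R⌉ + 1 := by linarith [h3.1, h3.2, h4.1, h4.2]
    exact ⟨by exact_mod_cast h6, by exact_mod_cast h7⟩
  exact ⟨fun i => (h2 i).1, fun i => (h2 i).2⟩

/-- `C_φ`, the cardinality of `ℤ^d_φ`. -/
def shiftCount {d : ℕ} (φ : (Fin d → ℝ) → ℝ) : ℕ := (activeShifts φ).ncard

/-- `Q(j, δ, 1) = [0,1) ∖ ⋃_{k=1}^{2^j-1} (k 2^{-j} - δ, k 2^{-j})`. -/
def goodInterval (j : ℕ) (δ : ℝ) : Set ℝ :=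
  Set.Ico 0 1 \ ⋃ k ∈ Set.Icc (1 : ℕ) (2 ^ j - 1),
    Set.Ioo ((k : ℝ) / 2 ^ j - δ) ((k : ℝ) / 2 ^ j)

/-- `Q(j, δ, d)`: the points of `ℝ^d` all of whose coordinates lie in `Q(j, δ, 1)`. -/
def goodCube (j : ℕ) (δ : ℝ) (d : ℕ) : Set (Fin d → ℝ) :=
  {x | ∀ i, x i ∈ goodInterval j δ}

end

/-! If `x` lies in the dyadic cube with corner `ν / 2^j`, then `g x` is the sum over the active
shifts `k` of `c (ν + k) * φ (2^j x - ν - k)`. Each summand is a coefficient depending only on the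
cube, times `φ` at a point that is affine in the fractional part of `2^j x`. The summands are
computed by `shiftCount φ` parallel networks.

The map `x ↦ ν` is discontinuous, but the good cube leaves a gap of length `δ` below each jump.
There a steep ReLU ramp equals the step function exactly, so `ν` and the fractional part are
obtained without error (`reach_mod`, `reach_cell`).

The coefficient is rounded to `r' * s'` binary digits, each a Boolean function of the cube number.
With `N = 2^r` and `L = 2^s` there are at most `N^2 * L^2` cubes, and one such function is realized
with width of order `N` and depth of order `L`. To this end the cube number is split into parts `(p,
u, b)`; the `L` bits for fixed `(p, u)` are packed into one integer, which is looked up by `(p, u)`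
and whose digit `b` is then extracted (`reach_lookup`, `reach_testBit`, `reach_table_mul`).
Multiplying a bounded nonnegative function by a bit is exact with one ReLU, so the product needs no
approximate multiplication (`reach_coeff_mul`).

The only errors are the rounding of the coefficient and the replacement of `φ` by `φ₀`. Each
contributes at most `M * ‖φ‖ * ε` per active shift. -/

/-! ### Calculus of functions reachable by ReLU layers -/

section Framework

/-- The affine combinations of a set of real-valued functions. -/
def affSpan {X : Type*} (A : Set (X → ℝ)) : Submodule ℝ (X → ℝ) :=
  Submodule.span ℝ (insert 1 A)

/-- The function `σ ∘ f`. -/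
def reluComp {X : Type*} (f : X → ℝ) : X → ℝ := fun x => relu (f x)

/-- `ReLUReach W h A B`: starting from the functions in `A`, a network with `h` hidden layers of
size at most `W` computes all functions in `B`. -/
inductive ReLUReach {X : Type*} (W : ℕ) : ℕ → Set (X → ℝ) → Set (X → ℝ) → Prop
  | refl {A B : Set (X → ℝ)} : B ⊆ affSpan A → ReLUReach W 0 A B
  | step {A B : Set (X → ℝ)} {h : ℕ} (S : Finset (X → ℝ)) : (S : Set (X → ℝ)) ⊆ affSpan A →
      S.card ≤ W → ReLUReach W h (reluComp '' (S : Set (X → ℝ))) B → ReLUReach W (h + 1) A B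

variable {X : Type*} {A B C A' B' : Set (X → ℝ)} {W W' h h' : ℕ}

theorem relu_of_nonneg {x : ℝ} (hx : 0 ≤ x) : relu x = x := max_eq_right hx

theorem relu_of_nonpos {x : ℝ} (hx : x ≤ 0) : relu x = 0 := max_eq_left hx

theorem relu_nonneg (x : ℝ) : 0 ≤ relu x := le_max_left _ _

theorem reluComp_of_nonneg {f : X → ℝ} (hf : ∀ x, 0 ≤ f x) : reluComp f = f :=
  funext fun x => relu_of_nonneg (hf x)

theorem subset_affSpan (A : Set (X → ℝ)) : A ⊆ affSpan A :=
  (Set.subset_insert _ _).trans Submodule.subset_span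

theorem mem_affSpan {f : X → ℝ} (hf : f ∈ A) : f ∈ affSpan A := subset_affSpan A hf

theorem one_mem_affSpan (A : Set (X → ℝ)) : (1 : X → ℝ) ∈ affSpan A :=
  Submodule.subset_span (Set.mem_insert _ _)

theorem const_mem_affSpan (A : Set (X → ℝ)) (c : ℝ) : (fun _ => c : X → ℝ) ∈ affSpan A := by
  have := (affSpan A).smul_mem c (one_mem_affSpan A)
  convert this using 1
  ext; simp

theorem affSpan_le (h : B ⊆ affSpan A) : affSpan B ≤ affSpan A :=
  Submodule.span_le.2 (Set.insert_subset (one_mem_affSpan A) h)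

theorem affSpan_mono (h : B ⊆ A) : affSpan B ≤ affSpan A :=
  affSpan_le (h.trans (subset_affSpan A))

theorem add_mem_affSpan {f g : X → ℝ} (hf : f ∈ affSpan A) (hg : g ∈ affSpan A) :
    (fun x => f x + g x) ∈ affSpan A := (affSpan A).add_mem hf hg

theorem sub_mem_affSpan {f g : X → ℝ} (hf : f ∈ affSpan A) (hg : g ∈ affSpan A) :
    (fun x => f x - g x) ∈ affSpan A := (affSpan A).sub_mem hf hg

theorem mul_mem_affSpan {f : X → ℝ} (c : ℝ) (hf : f ∈ affSpan A) :
    (fun x => c * f x) ∈ affSpan A := (affSpan A).smul_mem c hf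

theorem sum_mem_affSpan {ι : Type*} {s : Finset ι} {f : ι → X → ℝ}
    (hf : ∀ i ∈ s, f i ∈ affSpan A) : (fun x => ∑ i ∈ s, f i x) ∈ affSpan A := by
  have := (affSpan A).sum_mem hf
  convert this using 1
  ext; simp

namespace ReLUReach

theorem mono_left (hR : ReLUReach W h A B) (hA : A ⊆ affSpan A') : ReLUReach W h A' B := by
  cases hR with
  | refl hB => exact .refl (hB.trans (affSpan_le hA))
  | step S hS hc hr => exact .step S (hS.trans (affSpan_le hA)) hc hr

theorem mono_right (hR : ReLUReach W h A B) (hB : B' ⊆ affSpan B) : ReLUReach W h A B' := by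
  induction hR with
  | refl h1 => exact .refl (hB.trans (affSpan_le h1))
  | step S hS hc _ ih => exact .step S hS hc (ih hB)

theorem mono_width (hR : ReLUReach W h A B) (hW : W ≤ W') : ReLUReach W' h A B := by
  induction hR with
  | refl h1 => exact .refl h1
  | step S hS hc _ ih => exact .step S hS (hc.trans hW) ih

theorem trans (hR : ReLUReach W h A B) (hR' : ReLUReach W h' B C) :
    ReLUReach W (h + h') A C := by
  induction hR with
  | refl h1 => rw [zero_add]; exact hR'.mono_left h1
  | @step A B h S hS hc _ ih =>
    rw [add_right_comm]
    exact .step S hS hc (ih hR')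

theorem layer {S : Finset (X → ℝ)} (hS : (S : Set (X → ℝ)) ⊆ affSpan A) (hc : S.card ≤ W)
    (hB : B ⊆ affSpan (reluComp '' (S : Set (X → ℝ)))) : ReLUReach W 1 A B :=
  .step S hS hc (.refl hB)

theorem union (hR : ReLUReach W h A B) (hR' : ReLUReach W' h A' B') :
    ReLUReach (W + W') h (A ∪ A') (B ∪ B') := by
  classical
  induction hR generalizing A' B' with
  | refl h1 =>
    cases hR' with
    | refl h2 =>
      exact .refl (Set.union_subset (h1.trans (affSpan_mono Set.subset_union_left))
        (h2.trans (affSpan_mono Set.subset_union_right)))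
  | step S hS hc _ ih =>
    cases hR' with
    | step S' hS' hc' hr' =>
      refine .step (S ∪ S') ?_ ((Finset.card_union_le _ _).trans (add_le_add hc hc')) ?_
      · rw [Finset.coe_union]
        exact Set.union_subset (hS.trans (affSpan_mono Set.subset_union_left))
          (hS'.trans (affSpan_mono Set.subset_union_right))
      · rw [Finset.coe_union, Set.image_union]
        exact ih hr'

theorem union_same (hR : ReLUReach W h A B) (hR' : ReLUReach W' h A B') :
    ReLUReach (W + W') h A (B ∪ B') := by
  simpa using hR.union hR'

/-- ReLU fixes nonnegative functions, so transporting one through any number of layers costs one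
neuron per layer. For this reason every intermediate quantity below is kept nonnegative. -/
theorem carry (T : Finset (X → ℝ)) (hT : ∀ f ∈ T, f ∈ affSpan A) (h0 : ∀ f ∈ T, ∀ x, 0 ≤ f x)
    (h : ℕ) : ReLUReach T.card h A T := by
  have himg : reluComp '' (T : Set (X → ℝ)) = T := by
    have : Set.EqOn reluComp id (T : Set (X → ℝ)) := fun f hf => reluComp_of_nonneg (h0 f hf)
    rw [this.image_eq, Set.image_id]
  induction h generalizing A with
  | zero => exact .refl hT
  | succ h ih =>
    refine .step T hT le_rfl ?_
    rw [himg]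
    exact ih fun f hf => mem_affSpan hf

theorem union_carry (hR : ReLUReach W h A B) (T : Finset (X → ℝ))
    (hT : ∀ f ∈ T, f ∈ affSpan A) (h0 : ∀ f ∈ T, ∀ x, 0 ≤ f x) :
    ReLUReach (W + T.card) h A (B ∪ T) :=
  hR.union_same (carry T hT h0 h)

theorem iUnion {ι : Type*} (s : Finset ι) {D : ι → Set (X → ℝ)}
    (hR : ∀ i ∈ s, ReLUReach W h A (D i)) : ReLUReach (s.card * W) h A (⋃ i ∈ s, D i) := by
  classical
  induction s using Finset.induction_on with
  | empty => simpa using carry (A := A) ∅ (by simp) (by simp) h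
  | insert i s hi ih =>
    rw [Finset.card_insert_of_notMem hi, add_one_mul, add_comm, Finset.set_biUnion_insert]
    exact (hR i (by simp)).union_same (ih fun k hk => hR k (by simp [hk]))

end ReLUReach

theorem mem_affSpan_range {m : ℕ} {a : Fin m → X → ℝ} {f : X → ℝ}
    (hf : f ∈ affSpan (Set.range a)) :
    ∃ (v : Fin m → ℝ) (b : ℝ), ∀ x, f x = (v ⬝ᵥ fun i => a i x) + b := by
  obtain ⟨b, z, hz, rfl⟩ := Submodule.mem_span_insert.1 hf
  obtain ⟨v, rfl⟩ := (Submodule.mem_span_range_iff_exists_fun ℝ).1 hz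
  refine ⟨v, b, fun x => ?_⟩
  simp [dotProduct, add_comm]

/-- Membership in an affine span supplies a row of weights and a bias for each neuron. The extra
affine layer is the output, whence depth `h + 1`. -/
theorem ReLUReach.exists_network (hR : ReLUReach W h A B) {m k : ℕ} {a : Fin m → X → ℝ}
    (ha : A = Set.range a) {f : Fin k → X → ℝ} (hf : ∀ i, f i ∈ affSpan B) :
    ∃ net : ReLUNetwork m k, net.depth = h + 1 ∧ net.width ≤ W ∧
      ∀ x i, f i x = net.eval (fun l => a l x) i := by
  induction hR generalizing m with
  | refl h1 =>
    subst ha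
    choose v b hvb using fun i => mem_affSpan_range (affSpan_le h1 (hf i))
    exact ⟨.output (Matrix.of v) b, rfl, Nat.zero_le _, fun x i => hvb i x⟩
  | step S hS hc _ ih =>
    subst ha
    choose v b hvb using fun i => mem_affSpan_range (hS (S.equivFin.symm i).2)
    obtain ⟨net, h1, h2, h3⟩ := ih (a := fun i => reluComp (S.equivFin.symm i : X → ℝ)) (by
      ext g
      constructor
      · rintro ⟨g, hg, rfl⟩
        exact ⟨S.equivFin ⟨g, hg⟩, by simp⟩
      · rintro ⟨i, rfl⟩
        exact ⟨_, (S.equivFin.symm i).2, rfl⟩) hf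
    refine ⟨.hidden (Matrix.of v) b net, by simp [ReLUNetwork.depth, h1], max_le hc h2,
      fun x i => ?_⟩
    rw [h3, ReLUNetwork.eval]
    congr 1
    ext l
    simp only [reluComp, hvb l x]
    rfl

/-- Lets a given network serve as a block of a larger one. Its output layer is absorbed into the
next affine map, so only `depth - 1` layers are spent. -/
theorem ReLUReach.of_network {m k : ℕ} (net : ReLUNetwork m k) (A : Set (X → ℝ))
    {a : Fin m → X → ℝ} (ha : ∀ i, a i ∈ affSpan A) :
    ReLUReach net.width (net.depth - 1) A
      (Set.range fun i x => net.eval (fun l => a l x) i) := by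
  classical
  have key : ∀ {m n : ℕ} (a : Fin m → X → ℝ) (A : Set (X → ℝ)) (ha : ∀ i, a i ∈ affSpan A)
      (M : Matrix (Fin n) (Fin m) ℝ) (b : Fin n → ℝ) (i : Fin n),
      (fun x => (M *ᵥ (fun l => a l x) + b) i) ∈ affSpan A := by
    intro m n a A ha M b i
    have := add_mem_affSpan (sum_mem_affSpan (s := Finset.univ)
      fun l _ => mul_mem_affSpan (M i l) (ha l)) (const_mem_affSpan A (b i))
    exact this
  induction net generalizing A with
  | output M b =>
    refine .refl ?_
    rintro _ ⟨i, rfl⟩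
    exact key a A ha M b i
  | @hidden m n k M b rest ih =>
    have hd : rest.depth - 1 + 1 = rest.depth := by
      cases rest <;> simp [ReLUNetwork.depth]
    have h1 : (ReLUNetwork.hidden M b rest).depth - 1 = rest.depth - 1 + 1 := by
      simp [ReLUNetwork.depth, hd]
    rw [h1]
    refine .step (Finset.univ.image fun i x => (M *ᵥ (fun l => a l x) + b) i) ?_ ?_ ?_
    · intro f hf
      obtain ⟨i, -, rfl⟩ := Finset.mem_image.1 hf
      exact key a A ha M b i
    · refine Finset.card_image_le.trans ?_
      simp [ReLUNetwork.width]
    · refine (ih _ (a := fun i => reluComp fun x => (M *ᵥ (fun l => a l x) + b) i) ?_).mono_width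
        (le_max_right _ _)
      intro i
      exact mem_affSpan ⟨_, by simp, rfl⟩

end Framework

/-! ### Exact step functions, modular reduction and table lookup -/

section Gadgets

variable {X : Type*}

theorem reluComp_mem_affSpan_image {S : Finset (X → ℝ)} {f : X → ℝ} (hf : f ∈ S) :
    (fun x => relu (f x)) ∈ affSpan (reluComp '' (S : Set (X → ℝ))) :=
  mem_affSpan ⟨f, hf, rfl⟩

theorem mem_affSpan_image_of_nonneg {S : Finset (X → ℝ)} {f : X → ℝ} (hf : f ∈ S)
    (h0 : ∀ x, 0 ≤ f x) : f ∈ affSpan (reluComp '' (S : Set (X → ℝ))) :=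
  mem_affSpan ⟨f, hf, reluComp_of_nonneg h0⟩

/-- The left side is a ramp rising from 0 to 1 on `[T - η, T]`; it differs from the jump at `T` only
inside the excluded open interval. -/
theorem relu_sub_relu_eq_ite {z T η : ℝ} (hη : 0 < η) (hz : T ≤ z ∨ z ≤ T - η) :
    η⁻¹ * (relu (z - T + η) - relu (z - T)) = if T ≤ z then 1 else 0 := by
  rcases hz with hz | hz
  · rw [if_pos hz, relu_of_nonneg (by linarith), relu_of_nonneg (by linarith)]
    field_simp
    ring
  · rw [if_neg (by linarith), relu_of_nonpos (by linarith), relu_of_nonpos (by linarith)]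
    simp

theorem sum_range_ite_succ_le {n q : ℕ} (hq : q ≤ n) :
    ∑ a ∈ Finset.range n, (if a + 1 ≤ q then (1 : ℝ) else 0) = q := by
  rw [Finset.sum_boole]
  congr 1
  have : Finset.filter (fun a => a + 1 ≤ q) (Finset.range n) = Finset.range q := by
    ext a
    simp only [Finset.mem_filter, Finset.mem_range]
    omega
  rw [this, Finset.card_range]

/-- Reduction modulo `k * n` followed by reduction modulo `k` is reduction modulo `k`. This allows
the quotient to be stripped in stages. -/
theorem sub_mul_floor_div {z : ℝ} {k n : ℕ} (hz : 0 ≤ z) (hk : 0 < k) :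
    z - ((k * n : ℕ) : ℝ) * ⌊z / ((k * n : ℕ) : ℝ)⌋₊ -
      k * ⌊(z - ((k * n : ℕ) : ℝ) * ⌊z / ((k * n : ℕ) : ℝ)⌋₊) / k⌋₊ = z - k * ⌊z / k⌋₊ := by
  have hk' : (0 : ℝ) < k := by exact_mod_cast hk
  set q := ⌊z / ((k * n : ℕ) : ℝ)⌋₊
  have h1 : (z - ((k * n : ℕ) : ℝ) * q) / k = z / k - ((n * q : ℕ) : ℝ) := by
    push_cast
    field_simp
  have h2 : n * q ≤ ⌊z / k⌋₊ := by
    rcases Nat.eq_zero_or_pos n with rfl | hn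
    · simp
    · have h3 : (q : ℝ) ≤ z / ((k * n : ℕ) : ℝ) := Nat.floor_le (by positivity)
      have hn' : (0 : ℝ) < n := by exact_mod_cast hn
      apply Nat.le_floor
      rw [le_div_iff₀ (by positivity)] at h3 ⊢
      push_cast at h3 ⊢
      linarith
  rw [h1, Nat.floor_sub_natCast, Nat.cast_sub h2]
  push_cast
  ring

/-- Reduction modulo `k` of a function with values in `[0, k * 2 ^ n)` that avoids the intervals
`(T - η, T)` for integers `T`. -/
theorem reach_mod (r : ℕ) {η : ℝ} (hη : 0 < η) {k : ℕ} (hk : 0 < k) (c n : ℕ) (hn : n ≤ c * r)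
    (z : X → ℝ) (h0 : ∀ x, 0 ≤ z x) (hlt : ∀ x, z x < ((k * 2 ^ n : ℕ) : ℝ))
    (hz : ∀ x, ∀ T : ℕ, 1 ≤ T → T < k * 2 ^ n → (T : ℝ) ≤ z x ∨ z x ≤ T - η) :
    ReLUReach (2 ^ (r + 1)) c {z} {fun x => z x - k * ⌊z x / k⌋₊} := by
  classical
  induction c generalizing n z with
  | zero =>
    obtain rfl : n = 0 := by omega
    refine .refl ?_
    rintro _ rfl
    refine (congrArg (· ∈ affSpan {z}) (funext fun x => ?_)).mpr (mem_affSpan rfl)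
    have h1 := hlt x
    have h2 : ⌊z x / k⌋₊ = 0 := by
      rw [Nat.floor_eq_zero, div_lt_one (by exact_mod_cast hk)]
      simpa using h1
    simp [h2]
  | succ c ih =>
    -- One layer removes the top `e ≤ r` binary digits of the quotient by reducing modulo `D = k *
    -- 2^n'`. The floor of `z / D` counts the multiples of `D` passed, among `2^e - 1` candidates.
    -- Two neurons per candidate and one carrying `z` stay within `2^(r + 1)`.
    obtain ⟨e, n', rfl, her, hn'⟩ : ∃ e n', n = n' + e ∧ e ≤ r ∧ n' ≤ c * r :=
      ⟨min n r, n - min n r, by omega, by omega, by rw [add_one_mul] at hn; omega⟩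
    have hD0 : 0 < k * 2 ^ n' := by positivity
    obtain ⟨D, hD⟩ : ∃ D, D = k * 2 ^ n' := ⟨_, rfl⟩
    rw [← hD] at hD0
    have hDr : (0 : ℝ) < D := by exact_mod_cast hD0
    have htot : k * 2 ^ (n' + e) = D * 2 ^ e := by rw [hD]; ring
    rw [htot] at hlt hz
    let z' : X → ℝ := fun x => z x - D * ⌊z x / D⌋₊
    let S : Finset (X → ℝ) := insert z
      ((Finset.range (2 ^ e - 1)).image (fun a x => z x - ((D * (a + 1) : ℕ) : ℝ) + η) ∪
        (Finset.range (2 ^ e - 1)).image (fun a x => z x - ((D * (a + 1) : ℕ) : ℝ)))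
    have hq : ∀ x, ⌊z x / D⌋₊ ≤ 2 ^ e - 1 := by
      intro x
      have : ⌊z x / D⌋₊ < 2 ^ e := by
        rw [Nat.floor_lt (div_nonneg (h0 x) hDr.le), div_lt_iff₀ hDr]
        have := hlt x
        push_cast at this ⊢
        linarith
      omega
    have hz' : z' ∈ affSpan (reluComp '' (S : Set (X → ℝ))) := by
      have hz'eq : z' = fun x => z x - D * ∑ a ∈ Finset.range (2 ^ e - 1),
          (η⁻¹ * (relu (z x - ((D * (a + 1) : ℕ) : ℝ) + η) -
            relu (z x - ((D * (a + 1) : ℕ) : ℝ)))) := by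
        ext x
        simp only [z']
        rw [← sum_range_ite_succ_le (hq x)]
        congr 2
        refine Finset.sum_congr rfl fun a ha => ?_
        rw [Finset.mem_range] at ha
        rw [relu_sub_relu_eq_ite hη (hz x _ (Nat.mul_pos hD0 (Nat.succ_pos a))
          (Nat.mul_lt_mul_of_pos_left (by omega) hD0))]
        congr 1
        rw [Nat.le_floor_iff (div_nonneg (h0 x) hDr.le), le_div_iff₀ hDr, mul_comm]
        push_cast
        rfl
      rw [hz'eq]
      refine sub_mem_affSpan (mem_affSpan_image_of_nonneg (by simp [S]) h0)
        (mul_mem_affSpan _ (sum_mem_affSpan fun a ha => mul_mem_affSpan _ (sub_mem_affSpan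
          (reluComp_mem_affSpan_image (f := fun x => z x - ((D * (a + 1) : ℕ) : ℝ) + η) ?_)
          (reluComp_mem_affSpan_image (f := fun x => z x - ((D * (a + 1) : ℕ) : ℝ)) ?_))))
      · exact Finset.mem_insert_of_mem (Finset.mem_union_left _ (Finset.mem_image_of_mem _ ha))
      · exact Finset.mem_insert_of_mem (Finset.mem_union_right _ (Finset.mem_image_of_mem _ ha))
    have hflo : ∀ x, (D : ℝ) * ⌊z x / D⌋₊ ≤ z x := fun x => by
      have := Nat.floor_le (div_nonneg (h0 x) hDr.le)
      rwa [le_div_iff₀ hDr, mul_comm] at this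
    have hfup : ∀ x, z x < D * ⌊z x / D⌋₊ + D := fun x => by
      have := Nat.lt_floor_add_one (z x / D)
      rw [div_lt_iff₀ hDr] at this
      linarith
    -- The gap condition is inherited: `z'` differs from `z` by a multiple of `D`, so a threshold of
    -- `z'` is a threshold of `z` shifted by that multiple.
    have hrec := ih n' hn' z' (fun x => sub_nonneg.2 (hflo x))
      (fun x => by rw [← hD]; simp only [z']; linarith [hfup x]) (fun x T hT1 hT2 => by
        have h1 : D * ⌊z x / D⌋₊ + T < D * 2 ^ e := by
          have h2 : D * (⌊z x / D⌋₊ + 1) ≤ D * 2 ^ e :=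
            Nat.mul_le_mul_left _ (by have := hq x; have := Nat.one_le_two_pow (n := e); omega)
          rw [← hD] at hT2
          linarith
        have h3 := hz x _ (by omega) h1
        push_cast at h3
        simp only [z']
        exact h3.imp (fun h => by linarith) (fun h => by linarith))
    have heq : (fun x => z' x - k * ⌊z' x / k⌋₊) = fun x => z x - k * ⌊z x / k⌋₊ := by
      ext x
      simp only [z', hD]
      exact sub_mul_floor_div (h0 x) hk
    rw [heq] at hrec
    refine .step S ?_ ?_ (hrec.mono_left (by simpa using hz'))
    · have hmem : z ∈ affSpan {z} := mem_affSpan rfl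
      intro f hf
      simp only [S, Finset.coe_insert, Finset.coe_union, Finset.coe_image, Set.mem_insert_iff,
        Set.mem_union, Set.mem_image] at hf
      rcases hf with rfl | ⟨a, -, rfl⟩ | ⟨a, -, rfl⟩
      · exact hmem
      · exact add_mem_affSpan (sub_mem_affSpan hmem (const_mem_affSpan _ _))
          (const_mem_affSpan _ _)
      · exact sub_mem_affSpan hmem (const_mem_affSpan _ _)
    · refine (Finset.card_insert_le _ _).trans ?_
      have h1 := Finset.card_union_le
        ((Finset.range (2 ^ e - 1)).image (fun a x => z x - ((D * (a + 1) : ℕ) : ℝ) + η))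
        ((Finset.range (2 ^ e - 1)).image (fun a x => z x - ((D * (a + 1) : ℕ) : ℝ)))
      have h2 := Finset.card_image_le (s := Finset.range (2 ^ e - 1))
        (f := fun a x => z x - ((D * (a + 1) : ℕ) : ℝ) + η)
      have h3 := Finset.card_image_le (s := Finset.range (2 ^ e - 1))
        (f := fun a x => z x - ((D * (a + 1) : ℕ) : ℝ))
      rw [Finset.card_range] at h2 h3
      have h4 : 2 ^ e ≤ 2 ^ r := Nat.pow_le_pow_right (by norm_num) her
      have h5 := Nat.one_le_two_pow (n := e)
      rw [pow_succ]
      omega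

/-- Every function of a natural number `p < N` is an affine combination of the `σ(p - a)`. -/
theorem comp_mem_affSpan_relu_sub {N : ℕ} {p : X → ℕ} (hp : ∀ x, p x < N) (f : ℕ → ℝ) :
    (fun x => f (p x)) ∈ affSpan ((fun (a : ℕ) (x : X) => relu ((p x : ℝ) - a)) ''
      (Finset.range N : Set ℕ)) := by
  -- Telescoping: `σ(p - a) - σ(p - a - 1)` is the indicator of `a < p`, since `p` is an integer.
  have heq : (fun x => f (p x)) = fun x => f 0 + ∑ a ∈ Finset.range (N - 1),
      (f (a + 1) - f a) * (relu ((p x : ℝ) - a) - relu ((p x : ℝ) - (a + 1 : ℕ))) := by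
    ext x
    have h1 : ∀ a : ℕ, (f (a + 1) - f a) * (relu ((p x : ℝ) - a) - relu ((p x : ℝ) - (a + 1 : ℕ)))
        = f (min (a + 1) (p x)) - f (min a (p x)) := by
      intro a
      rcases Nat.lt_or_ge a (p x) with ha | ha
      · have h2 : ((a + 1 : ℕ) : ℝ) ≤ p x := by exact_mod_cast ha
        have h3 := h2
        push_cast at h3
        rw [relu_of_nonneg (by linarith), relu_of_nonneg (by linarith), min_eq_left ha.le,
          min_eq_left ha]
        push_cast
        ring
      · have h2 : (p x : ℝ) ≤ a := by exact_mod_cast ha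
        rw [relu_of_nonpos (by linarith), relu_of_nonpos (by push_cast; linarith),
          min_eq_right ha, min_eq_right (by omega)]
        ring
    simp only [h1]
    rw [Finset.sum_range_sub fun a => f (min a (p x))]
    have := hp x
    rw [min_eq_right (by omega : p x ≤ N - 1)]
    simp
  rw [heq]
  refine add_mem_affSpan (const_mem_affSpan _ _) (sum_mem_affSpan fun a ha =>
    mul_mem_affSpan _ (sub_mem_affSpan (mem_affSpan ⟨a, ?_, rfl⟩) (mem_affSpan ⟨a + 1, ?_, rfl⟩)))
  all_goals
    simp only [Finset.coe_range, Set.mem_Iio, Finset.mem_range] at ha ⊢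
    omega

theorem two_mul_relu_sub_self (x : ℝ) : 2 * relu x - x = |x| := by
  rcases le_total 0 x with hx | hx
  · rw [relu_of_nonneg hx, abs_of_nonneg hx]; ring
  · rw [relu_of_nonpos hx, abs_of_nonpos hx]; ring

/-- Selecting the value at the natural number `i`: other indices are penalized. -/
theorem relu_sub_mul_abs {y K : ℝ} (h0 : 0 ≤ y) (hK : y ≤ K) (u i : ℕ) :
    relu (y - K * (2 * relu ((u : ℝ) - i) - (u - i))) = if u = i then y else 0 := by
  rw [two_mul_relu_sub_self]
  split_ifs with hu
  · subst hu
    simp [relu_of_nonneg h0]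
  · apply relu_of_nonpos
    have h1 : (1 : ℝ) ≤ |(u : ℝ) - i| := by
      have : (1 : ℤ) ≤ |(u : ℤ) - i| := Int.one_le_abs (by omega)
      exact_mod_cast this
    nlinarith

/-- The table is scanned in blocks of `N` indices, two layers per block. The first computes `σ(u -
i)`, which yields `|u - i|`; the second applies ReLU to `F i - K * |u - i|`, which survives only for
`i = u`, and adds the result to `acc`. Every `F i` is affine in the functions of `P`, so carrying
`P` makes the whole table available. `P`, `u` and `acc` occupy `N + 2` neurons besides the `N`
working ones. -/
theorem reach_lookup (P : Finset (X → ℝ)) (hP : ∀ f ∈ P, ∀ x, 0 ≤ f x) {N : ℕ}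
    (hN : P.card ≤ N) (u : X → ℕ) (F : ℕ → X → ℝ) (hF : ∀ i, F i ∈ affSpan (P : Set (X → ℝ)))
    {K : ℝ} (hF0 : ∀ i x, 0 ≤ F i x) (hFK : ∀ i x, F i x ≤ K) (n : ℕ) (acc : X → ℝ)
    (hacc : ∀ x, 0 ≤ acc x) :
    ReLUReach (2 * N + 2) (2 * n) ((P : Set (X → ℝ)) ∪ {fun x => (u x : ℝ), acc})
      {fun x => acc x + if u x < N * n then F (u x) x else 0} := by
  classical
  induction n generalizing acc with
  | zero =>
    refine .refl ?_
    rintro _ rfl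
    simpa using mem_affSpan (A := (P : Set (X → ℝ)) ∪ {fun x => (u x : ℝ), acc}) (by simp)
  | succ n ih =>
    let A₀ : Set (X → ℝ) := (P : Set (X → ℝ)) ∪ {fun x => (u x : ℝ), acc}
    let T : Finset (X → ℝ) := P ∪ {fun x => (u x : ℝ), acc}
    have hTA : (T : Set (X → ℝ)) = A₀ := by simp [T, A₀]
    have hT0 : ∀ f ∈ T, ∀ x, 0 ≤ f x := by
      intro f hf
      simp only [T, Finset.mem_union, Finset.mem_insert, Finset.mem_singleton] at hf
      rcases hf with hf | rfl | rfl
      · exact hP f hf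
      · exact fun x => Nat.cast_nonneg _
      · exact hacc
    have hTc : T.card ≤ N + 2 :=
      (Finset.card_union_le _ _).trans (add_le_add hN Finset.card_le_two)
    let d : ℕ → X → ℝ := fun i x => (u x : ℝ) - ((N * n + i : ℕ) : ℝ)
    let S₁ : Finset (X → ℝ) := (Finset.range N).image d
    have hd : ∀ (D : Set (X → ℝ)), (fun x => (u x : ℝ)) ∈ affSpan D → ∀ i, d i ∈ affSpan D :=
      fun D hD i => sub_mem_affSpan hD (const_mem_affSpan _ _)
    have hu : (fun x => (u x : ℝ)) ∈ A₀ := by simp [A₀]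
    have hS₁ : S₁.card ≤ N := Finset.card_image_le.trans (Finset.card_range N).le
    have R₁ : ReLUReach (2 * N + 2) 1 A₀ (reluComp '' (S₁ : Set (X → ℝ)) ∪ T) := by
      refine ((ReLUReach.layer (S := S₁) (A := A₀) ?_ hS₁ (subset_affSpan _)).union_carry T
        (fun f hf => ?_) hT0).mono_width (by omega)
      · intro f hf
        obtain ⟨i, -, rfl⟩ := Finset.mem_image.1 hf
        exact hd _ (mem_affSpan hu) i
      · exact mem_affSpan (by rw [← hTA]; exact hf)
    let G : ℕ → X → ℝ := fun i x => F (N * n + i) x - K * (2 * relu (d i x) - d i x)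
    let S₂ : Finset (X → ℝ) := (Finset.range N).image G
    have hS₂ : S₂.card ≤ N := Finset.card_image_le.trans (Finset.card_range N).le
    let acc' : X → ℝ := fun x => acc x + ∑ i ∈ Finset.range N, relu (G i x)
    have R₂ : ReLUReach (2 * N + 2) 1 (reluComp '' (S₁ : Set (X → ℝ)) ∪ T)
        ((P : Set (X → ℝ)) ∪ {fun x => (u x : ℝ), acc'}) := by
      refine ((((ReLUReach.layer (S := S₂) (A := reluComp '' (S₁ : Set (X → ℝ)) ∪ T) ?_ hS₂
        (subset_affSpan _)).union_carry T (fun f hf => mem_affSpan (Or.inr hf)) hT0)).mono_width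
        (by omega)).mono_right ?_
      · intro f hf
        obtain ⟨i, hi, rfl⟩ := Finset.mem_image.1 hf
        refine sub_mem_affSpan (affSpan_mono (fun g hg => Or.inr ?_) (hF _))
          (mul_mem_affSpan _ (sub_mem_affSpan (mul_mem_affSpan _ (mem_affSpan (Or.inl
            ⟨d i, Finset.mem_image_of_mem _ hi, rfl⟩)))
            (hd _ (mem_affSpan (Or.inr ?_)) i)))
        · rw [hTA]; exact Or.inl hg
        · rw [hTA]; exact hu
      · rintro f (hf | rfl | rfl)
        · exact mem_affSpan (Or.inr (by rw [hTA]; exact Or.inl hf))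
        · exact mem_affSpan (Or.inr (by rw [hTA]; exact hu))
        · refine add_mem_affSpan (mem_affSpan (Or.inr (by rw [hTA]; simp [A₀])))
            (sum_mem_affSpan fun i hi => mem_affSpan (Or.inl
              ⟨G i, Finset.mem_image_of_mem _ hi, rfl⟩))
    have R₃ := ih acc' (fun x => add_nonneg (hacc x) (Finset.sum_nonneg fun i _ => relu_nonneg _))
    have hR := (R₁.trans R₂).trans R₃
    have hstep : 1 + 1 + 2 * n = 2 * (n + 1) := by ring
    rw [hstep] at hR
    convert hR using 2
    ext x
    simp only [acc', G, d]
    have h1 : ∀ i ∈ Finset.range N, relu (F (N * n + i) x - K * (2 * relu ((u x : ℝ) -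
        ((N * n + i : ℕ) : ℝ)) - ((u x : ℝ) - ((N * n + i : ℕ) : ℝ)))) =
        if u x = N * n + i then F (u x) x else 0 := by
      intro i _
      rw [relu_sub_mul_abs (hF0 _ x) (hFK _ x)]
      split_ifs with hi
      · rw [hi]
      · rfl
    rw [Finset.sum_congr rfl h1, add_assoc]
    congr 1
    rw [mul_add_one]
    by_cases h2 : u x < N * n
    · rw [if_pos h2, if_pos (by omega), Finset.sum_eq_zero, zero_add]
      intro i _
      rw [if_neg (by omega)]
    · rw [if_neg h2, add_zero]
      by_cases h3 : u x < N * n + N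
      · rw [if_pos h3, Finset.sum_eq_single (u x - N * n), if_pos (by omega)]
        · intro i _ hi
          rw [if_neg (by omega)]
        · intro hi
          exact absurd (Finset.mem_range.2 (by omega)) hi
      · rw [if_neg h3, Finset.sum_eq_zero]
        intro i hi
        rw [Finset.mem_range] at hi
        rw [if_neg (by omega)]

end Gadgets

/-! ### Extraction of stored bits -/

section BitExtraction

variable {X : Type*}

theorem testBit_toNat_eq_ite {z n : ℕ} (hz : z < 2 ^ (n + 1)) :
    ((z.testBit n).toNat : ℝ) = if ((2 ^ n : ℕ) : ℝ) ≤ z then 1 else 0 := by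
  rw [Nat.toNat_testBit]
  have h2 : z / 2 ^ n < 2 := by
    rw [Nat.div_lt_iff_lt_mul (by positivity)]
    rw [pow_succ] at hz
    linarith
  split_ifs with h
  · have h1 : 1 ≤ z / 2 ^ n := by
      rw [Nat.le_div_iff_mul_le (by positivity), one_mul]
      exact_mod_cast h
    have : z / 2 ^ n % 2 = 1 := by omega
    simp [this]
  · have : z / 2 ^ n = 0 := Nat.div_eq_of_lt (by exact_mod_cast not_le.1 h)
    simp [this]

theorem cast_mod_two_pow {z n : ℕ} (hz : z < 2 ^ (n + 1)) :
    ((z % 2 ^ n : ℕ) : ℝ) = z - 2 ^ n * (z.testBit n).toNat := by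
  rw [Nat.toNat_testBit]
  have h2 : z / 2 ^ n < 2 := by
    rw [Nat.div_lt_iff_lt_mul (by positivity)]
    rw [pow_succ] at hz
    linarith
  rw [Nat.mod_eq_of_lt h2, eq_sub_iff_add_eq]
  exact_mod_cast Nat.mod_add_div z (2 ^ n)

theorem sum_two_pow_mul_testBit (z B : ℕ) :
    ∑ l ∈ Finset.range B, 2 ^ l * (z.testBit l).toNat = z % 2 ^ B := by
  induction B with
  | zero => simp [Nat.mod_one]
  | succ B ih => rw [Finset.sum_range_succ, ih, Nat.mod_pow_succ, Nat.toNat_testBit]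

/-- Extraction of the binary digit of `z` at the position `b`. -/
theorem reach_testBit (n : ℕ) (z b : X → ℕ) (hz : ∀ x, z x < 2 ^ n) (acc : X → ℝ)
    (hacc : ∀ x, 0 ≤ acc x) :
    ReLUReach 6 (2 * n) {fun x => (z x : ℝ), fun x => (b x : ℝ), acc}
      {fun x => acc x + if b x < n then (((z x).testBit (b x)).toNat : ℝ) else 0} := by
  classical
  induction n generalizing z acc with
  | zero =>
    refine .refl ?_
    rintro _ rfl
    simpa using mem_affSpan (A := {fun x => (z x : ℝ), fun x => (b x : ℝ), acc}) (by simp)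
  | succ n ih =>
    let A₀ : Set (X → ℝ) := {fun x => (z x : ℝ), fun x => (b x : ℝ), acc}
    let bit : X → ℝ := fun x => (((z x).testBit n).toNat : ℝ)
    have hA : ∀ f ∈ A₀, ∀ x, 0 ≤ f x := by
      rintro f (rfl | rfl | rfl) x
      exacts [Nat.cast_nonneg _, Nat.cast_nonneg _, hacc x]
    -- The top digit of the integer `z` is the jump at `2^n`; integers leave a gap of length 1, so a
    -- ramp of slope 1 is exact.
    let T₁ : X → ℝ := fun x => (z x : ℝ) - ((2 ^ n : ℕ) : ℝ) + 1
    let T₂ : X → ℝ := fun x => (z x : ℝ) - ((2 ^ n : ℕ) : ℝ)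
    let D : X → ℝ := fun x => (b x : ℝ) - n
    have hz₀ : (fun x => (z x : ℝ)) ∈ A₀ := by simp [A₀]
    have hb₀ : (fun x => (b x : ℝ)) ∈ A₀ := by simp [A₀]
    have hacc₀ : acc ∈ A₀ := by simp [A₀]
    let S₁ : Finset (X → ℝ) := {T₁, T₂, D} ∪ {fun x => (z x : ℝ), fun x => (b x : ℝ), acc}
    have hS₁ : S₁.card ≤ 6 := (Finset.card_union_le _ _).trans
      (add_le_add Finset.card_le_three Finset.card_le_three)
    let B₁ : Set (X → ℝ) := {bit, fun x => relu (D x)} ∪ A₀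
    have R₁ : ReLUReach 6 1 A₀ B₁ := by
      refine ReLUReach.layer (S := S₁) ?_ hS₁ ?_
      · intro f hf
        simp only [S₁, Finset.coe_union, Finset.coe_insert, Finset.coe_singleton] at hf
        have h2 := sub_mem_affSpan (mem_affSpan hz₀) (const_mem_affSpan A₀ ((2 ^ n : ℕ) : ℝ))
        rcases hf with (rfl | rfl | rfl) | hf
        · exact add_mem_affSpan h2 (const_mem_affSpan A₀ 1)
        · exact h2
        · exact sub_mem_affSpan (mem_affSpan hb₀) (const_mem_affSpan A₀ _)
        · exact mem_affSpan hf
      · rintro f ((rfl | rfl) | hf)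
        · have heq : bit = fun x => 1⁻¹ * (relu (T₁ x) - relu (T₂ x)) := by
            ext x
            simp only [bit, T₁, T₂]
            rw [testBit_toNat_eq_ite (hz x), relu_sub_relu_eq_ite one_pos]
            rcases Nat.lt_or_ge (z x) (2 ^ n) with h | h
            · right
              rw [le_sub_iff_add_le]
              exact_mod_cast h
            · left
              exact_mod_cast h
          rw [heq]
          exact mul_mem_affSpan _ (sub_mem_affSpan
            (reluComp_mem_affSpan_image (by simp [S₁])) (reluComp_mem_affSpan_image (by simp [S₁])))
        · exact reluComp_mem_affSpan_image (by simp [S₁])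
        · refine mem_affSpan_image_of_nonneg ?_ (hA f hf)
          rcases hf with (rfl | rfl | rfl) <;> simp [S₁]
    -- The penalty `|b - n|` is at least 1 unless `n` is the requested position, so only that bit
    -- reaches the accumulator. The remaining digits form `z'`.
    let G : X → ℝ := fun x => bit x - 1 * (2 * relu ((b x : ℝ) - n) - ((b x : ℝ) - n))
    let z' : X → ℕ := fun x => z x % 2 ^ n
    let acc' : X → ℝ := fun x => acc x + relu (G x)
    let S₂ : Finset (X → ℝ) := {G, fun x => (z' x : ℝ)} ∪ {fun x => (b x : ℝ), acc}
    have hS₂ : S₂.card ≤ 6 := ((Finset.card_union_le _ _).trans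
      (add_le_add Finset.card_le_two Finset.card_le_two)).trans (by norm_num)
    have R₂ : ReLUReach 6 1 B₁ {fun x => (z' x : ℝ), fun x => (b x : ℝ), acc'} := by
      refine ReLUReach.layer (S := S₂) ?_ hS₂ ?_
      · intro f hf
        simp only [S₂, Finset.coe_union, Finset.coe_insert, Finset.coe_singleton] at hf
        have hbit : bit ∈ affSpan B₁ := mem_affSpan (by simp [B₁])
        rcases hf with (rfl | rfl) | (rfl | rfl)
        · exact sub_mem_affSpan hbit (mul_mem_affSpan _ (sub_mem_affSpan
            (mul_mem_affSpan _ (mem_affSpan (by simp [B₁, D])))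
            (sub_mem_affSpan (mem_affSpan (Or.inr hb₀)) (const_mem_affSpan _ _))))
        · have heq : (fun x => (z' x : ℝ)) = fun x => (z x : ℝ) - 2 ^ n * bit x :=
            funext fun x => cast_mod_two_pow (hz x)
          rw [heq]
          exact sub_mem_affSpan (mem_affSpan (Or.inr hz₀)) (mul_mem_affSpan _ hbit)
        · exact mem_affSpan (Or.inr hb₀)
        · exact mem_affSpan (Or.inr hacc₀)
      · rintro f (rfl | rfl | rfl)
        · exact mem_affSpan_image_of_nonneg (by simp [S₂]) fun x => Nat.cast_nonneg _
        · exact mem_affSpan_image_of_nonneg (by simp [S₂]) fun x => Nat.cast_nonneg _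
        · exact add_mem_affSpan (mem_affSpan_image_of_nonneg (by simp [S₂]) hacc)
            (reluComp_mem_affSpan_image (by simp [S₂]))
    have R₃ := ih z' (fun x => Nat.mod_lt _ (by positivity)) acc'
      (fun x => add_nonneg (hacc x) (relu_nonneg _))
    have hR := (R₁.trans R₂).trans R₃
    have hstep : 1 + 1 + 2 * n = 2 * (n + 1) := by ring
    rw [hstep] at hR
    convert hR using 2
    ext x
    have hbit1 : bit x ≤ 1 := by
      simp only [bit]
      exact_mod_cast Bool.toNat_le _
    simp only [acc', G, z']
    rw [relu_sub_mul_abs (Nat.cast_nonneg _) hbit1, add_assoc, Nat.testBit_mod_two_pow]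
    congr 1
    rcases Nat.lt_trichotomy (b x) n with h | h | h
    · rw [if_pos (by omega), if_neg h.ne, if_pos h]
      simp [h]
    · rw [if_pos (by omega), if_pos h, if_neg (by omega), add_zero, h]
    · rw [if_neg (by omega), if_neg h.ne', if_neg (by omega), add_zero]

/-- Multiplication of a bounded nonnegative function by a function with values in `{0, 1}`. -/
theorem reach_bit_mul (β : X → Bool) (v : X → ℝ) {K : ℝ} (hv0 : ∀ x, 0 ≤ v x)
    (hvK : ∀ x, v x ≤ K) :
    ReLUReach 2 1 {fun x => ((β x).toNat : ℝ), v}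
      {fun x => ((β x).toNat : ℝ), fun x => ((β x).toNat : ℝ) * v x} := by
  classical
  let S : Finset (X → ℝ) :=
    {fun x => ((β x).toNat : ℝ), fun x => v x - K * (1 - ((β x).toNat : ℝ))}
  refine ReLUReach.layer (S := S) ?_ Finset.card_le_two ?_
  · intro f hf
    simp only [S, Finset.coe_insert, Finset.coe_singleton] at hf
    have h1 : (fun x => ((β x).toNat : ℝ)) ∈
        affSpan ({fun x => ((β x).toNat : ℝ), v} : Set (X → ℝ)) := mem_affSpan (by simp)
    rcases hf with rfl | rfl
    · exact h1
    · exact sub_mem_affSpan (mem_affSpan (by simp))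
        (mul_mem_affSpan _ (sub_mem_affSpan (const_mem_affSpan _ _) h1))
  · rintro f (rfl | rfl)
    · exact mem_affSpan_image_of_nonneg (by simp [S]) fun x => Nat.cast_nonneg _
    · have heq : (fun x => ((β x).toNat : ℝ) * v x) =
          fun x => relu (v x - K * (1 - ((β x).toNat : ℝ))) := by
        ext x
        cases β x
        · rw [relu_of_nonpos] <;> simp [hvK x]
        · rw [relu_of_nonneg] <;> simp [hv0 x]
      rw [heq]
      exact reluComp_mem_affSpan_image (by simp [S])

/-- A table of `N * (N * L) * L` bits, read at `(p, u, b)` and multiplied by `v`. -/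
theorem reach_table_mul {N L : ℕ} (hN : 2 ≤ N) (p u b : X → ℕ) (hp : ∀ x, p x < N)
    (hu : ∀ x, u x < N * L) (hb : ∀ x, b x < L) (v : X → ℝ) {K : ℝ} (hv0 : ∀ x, 0 ≤ v x)
    (hvK : ∀ x, v x ≤ K) (β : ℕ → ℕ → ℕ → Bool) :
    ReLUReach (2 * N + 4) (4 * L + 2)
      {fun x => (p x : ℝ), fun x => (u x : ℝ), fun x => (b x : ℝ), v}
      {fun x => ((β (p x) (u x) (b x)).toNat : ℝ),
        fun x => ((β (p x) (u x) (b x)).toNat : ℝ) * v x} := by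
  classical
  let A₀ : Set (X → ℝ) := {fun x => (p x : ℝ), fun x => (u x : ℝ), fun x => (b x : ℝ), v}
  let S : Finset (X → ℝ) := (Finset.range N).image fun (a : ℕ) x => (p x : ℝ) - a
  let P : Finset (X → ℝ) := (Finset.range N).image fun (a : ℕ) x => relu ((p x : ℝ) - a)
  have hSP : reluComp '' (S : Set (X → ℝ)) = P := by
    simp only [S, P, Finset.coe_image, Set.image_image]
    rfl
  have hSc : S.card ≤ N := Finset.card_image_le.trans (Finset.card_range N).le
  have hPc : P.card ≤ N := Finset.card_image_le.trans (Finset.card_range N).le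
  have hP0 : ∀ f ∈ P, ∀ x, 0 ≤ f x := by
    intro f hf
    obtain ⟨a, -, rfl⟩ := Finset.mem_image.1 hf
    exact fun x => relu_nonneg _
  let T : Finset (X → ℝ) := {fun x => (b x : ℝ), v}
  have hT0 : ∀ f ∈ T, ∀ x, 0 ≤ f x := by
    intro f hf
    simp only [T, Finset.mem_insert, Finset.mem_singleton] at hf
    rcases hf with rfl | rfl
    exacts [fun x => Nat.cast_nonneg _, hv0]
  have hTc : T.card ≤ 2 := Finset.card_le_two
  let U : Finset (X → ℝ) := insert (fun x => (u x : ℝ)) T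
  have hUc : U.card ≤ 3 := Finset.card_le_three
  have R₁ : ReLUReach (2 * N + 4) 1 A₀ (P ∪ U) := by
    rw [← hSP]
    refine ((ReLUReach.layer (S := S) (A := A₀) ?_ hSc (subset_affSpan _)).union_carry U
      ?_ ?_).mono_width (by omega)
    · intro f hf
      obtain ⟨a, -, rfl⟩ := Finset.mem_image.1 hf
      exact sub_mem_affSpan (mem_affSpan (by simp [A₀])) (const_mem_affSpan _ _)
    · intro f hf
      simp only [U, T, Finset.mem_insert, Finset.mem_singleton] at hf
      rcases hf with rfl | rfl | rfl <;> exact mem_affSpan (by simp [A₀])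
    · intro f hf
      rcases Finset.mem_insert.1 hf with rfl | hf
      exacts [fun x => Nat.cast_nonneg _, hT0 f hf]
  -- Packing the `L` bits of a row into one integer leaves a lookup over `(p, u)` only. For fixed
  -- `w` the entry `E (p x) w` depends on `p` alone and is thus affine in the functions of `P`.
  let E : ℕ → ℕ → ℕ := fun q w => Nat.ofBits fun c : Fin L => β q w c
  let G : X → ℕ := fun x => E (p x) (u x)
  have hG : ∀ x, G x < 2 ^ L := fun x => Nat.ofBits_lt_two_pow _
  have R₂ : ReLUReach (2 * N + 4) (2 * L) (P ∪ U) ({fun x => (G x : ℝ)} ∪ T) := by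
    have h1 := reach_lookup P hP0 hPc u (fun w x => (E (p x) w : ℝ)) (fun w => by
        have := comp_mem_affSpan_relu_sub hp (fun q => (E q w : ℝ))
        simpa [P] using this)
      (K := 2 ^ L) (fun _ _ => Nat.cast_nonneg _) (fun w x => by
        exact_mod_cast (Nat.ofBits_lt_two_pow _).le) L (fun _ => 0) (fun _ => le_rfl)
    have h2 : (fun x => (0 : ℝ) + if u x < N * L then (E (p x) (u x) : ℝ) else 0) =
        fun x => (G x : ℝ) := by
      ext x
      rw [if_pos (hu x), zero_add]
    rw [h2] at h1
    refine ((h1.mono_left (A' := (P : Set (X → ℝ)) ∪ U) ?_).union_carry T (fun f hf => ?_)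
      hT0).mono_width (by omega)
    · rintro f (hf | rfl | rfl)
      · exact mem_affSpan (Or.inl hf)
      · exact mem_affSpan (Or.inr (by simp [U]))
      · exact const_mem_affSpan _ _
    · exact mem_affSpan (Or.inr (by simp only [U, Finset.coe_insert]; exact Or.inr hf))
  let bit : X → ℝ := fun x => ((β (p x) (u x) (b x)).toNat : ℝ)
  have R₃ : ReLUReach (2 * N + 4) (2 * L) ({fun x => (G x : ℝ)} ∪ (T : Set (X → ℝ)))
      ({bit} ∪ (({v} : Finset (X → ℝ)) : Set (X → ℝ))) := by
    have h1 := reach_testBit L G b hG (fun _ => 0) (fun _ => le_rfl)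
    have h2 : (fun x => (0 : ℝ) + if b x < L then (((G x).testBit (b x)).toNat : ℝ) else 0) =
        bit := by
      ext x
      rw [if_pos (hb x), zero_add]
      simp only [G, E, bit]
      rw [Nat.testBit_ofBits_lt _ _ (hb x)]
    rw [h2] at h1
    refine ((h1.mono_left ?_).union_carry {v} (fun f hf => ?_) (fun f hf => ?_)).mono_width ?_
    · rintro f (rfl | rfl | rfl)
      · exact mem_affSpan (Or.inl rfl)
      · exact mem_affSpan (Or.inr (by simp [T]))
      · exact const_mem_affSpan _ _
    · rw [Finset.mem_singleton.1 hf]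
      exact mem_affSpan (Or.inr (by simp [T]))
    · rw [Finset.mem_singleton.1 hf]
      exact hv0
    · rw [Finset.card_singleton]
      -- This is where `2 ≤ N` enters: extraction needs 6 neurons, plus one carrying `v`.
      omega
  have R₄ : ReLUReach (2 * N + 4) 1 ({bit} ∪ (({v} : Finset (X → ℝ)) : Set (X → ℝ)))
      {bit, fun x => bit x * v x} := by
    refine ((reach_bit_mul (fun x => β (p x) (u x) (b x)) v hv0 hvK).mono_width
      (by omega)).mono_left ?_
    rintro f (rfl | rfl)
    · exact mem_affSpan (Or.inl rfl)
    · exact mem_affSpan (Or.inr (by simp))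
  have hR := ((R₁.trans R₂).trans R₃).trans R₄
  have hlen : 1 + 2 * L + 2 * L + 1 = 4 * L + 2 := by ring
  rwa [hlen] at hR

end BitExtraction

/-! ### Products with quantized coefficients -/

section BitSums

variable {X : Type*}

/-- In each of `s` rounds `r` tables are read in parallel. Both running sums, with and without the
factor `v`, are carried along with `p`, `u`, `b`, `v`, which accounts for the 6 extra neurons. The
sum without `v` is needed later to undo a shift of `v`. -/
theorem reach_bit_sums {N L : ℕ} (hN : 2 ≤ N) (p u b : X → ℕ) (hp : ∀ x, p x < N)
    (hu : ∀ x, u x < N * L) (hb : ∀ x, b x < L) (v : X → ℝ) {K : ℝ} (hv0 : ∀ x, 0 ≤ v x)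
    (hvK : ∀ x, v x ≤ K) (β : ℕ → ℕ → ℕ → ℕ → Bool) (r s : ℕ) :
    ReLUReach (r * (2 * N + 4) + 6) (s * (4 * L + 2))
      {fun x => (p x : ℝ), fun x => (u x : ℝ), fun x => (b x : ℝ), v}
      {fun x => (p x : ℝ), fun x => (u x : ℝ), fun x => (b x : ℝ), v,
        fun x => ∑ l ∈ Finset.range (r * s), 2 ^ l * ((β l (p x) (u x) (b x)).toNat : ℝ),
        fun x => ∑ l ∈ Finset.range (r * s),
          2 ^ l * (((β l (p x) (u x) (b x)).toNat : ℝ) * v x)} := by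
  classical
  induction s with
  | zero =>
    rw [zero_mul]
    refine .refl ?_
    rintro f (rfl | rfl | rfl | rfl | rfl | rfl)
    · exact mem_affSpan (by simp)
    · exact mem_affSpan (by simp)
    · exact mem_affSpan (by simp)
    · exact mem_affSpan (by simp)
    · simpa using const_mem_affSpan _ 0
    · simpa using const_mem_affSpan _ 0
  | succ s ih =>
    rw [add_one_mul]
    refine ih.trans ?_
    let bit : ℕ → X → ℝ := fun l x => ((β l (p x) (u x) (b x)).toNat : ℝ)
    let T : Finset (X → ℝ) :=
      {fun x => (p x : ℝ), fun x => (u x : ℝ), fun x => (b x : ℝ), v,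
        fun x => ∑ l ∈ Finset.range (r * s), 2 ^ l * bit l x,
        fun x => ∑ l ∈ Finset.range (r * s), 2 ^ l * (bit l x * v x)}
    have hT0 : ∀ f ∈ T, ∀ x, 0 ≤ f x := by
      intro f hf x
      simp only [T, Finset.mem_insert, Finset.mem_singleton] at hf
      have hbit : ∀ l, 0 ≤ bit l x := fun l => Nat.cast_nonneg _
      rcases hf with rfl | rfl | rfl | rfl | rfl | rfl
      · exact Nat.cast_nonneg _
      · exact Nat.cast_nonneg _
      · exact Nat.cast_nonneg _
      · exact hv0 x
      · exact Finset.sum_nonneg fun l _ => mul_nonneg (by positivity) (hbit l)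
      · exact Finset.sum_nonneg fun l _ =>
          mul_nonneg (by positivity) (mul_nonneg (hbit l) (hv0 x))
    have hT : (T : Set (X → ℝ)) = {fun x => (p x : ℝ), fun x => (u x : ℝ), fun x => (b x : ℝ), v,
        fun x => ∑ l ∈ Finset.range (r * s), 2 ^ l * bit l x,
        fun x => ∑ l ∈ Finset.range (r * s), 2 ^ l * (bit l x * v x)} := by simp [T]
    have hTc : T.card ≤ 6 := Finset.card_le_six
    change ReLUReach _ _ {fun x => (p x : ℝ), fun x => (u x : ℝ), fun x => (b x : ℝ), v,
        fun x => ∑ l ∈ Finset.range (r * s), 2 ^ l * bit l x,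
        fun x => ∑ l ∈ Finset.range (r * s), 2 ^ l * (bit l x * v x)} _
    rw [← hT]
    have R := ((ReLUReach.iUnion (A := (T : Set (X → ℝ))) (W := 2 * N + 4) (h := 4 * L + 2)
      (Finset.range r) (D := fun l => {bit (r * s + l), fun x => bit (r * s + l) x * v x})
      (fun l _ => (reach_table_mul hN p u b hp hu hb v hv0 hvK (β (r * s + l))).mono_left
        (by
          rintro f (rfl | rfl | rfl | rfl) <;> exact mem_affSpan (by simp [T])))).union_carry T
      (fun f hf => mem_affSpan hf) hT0)
    rw [Finset.card_range] at R
    refine (R.mono_width (by omega)).mono_right ?_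
    have hmem : ∀ l ∈ Finset.range r, ∀ f ∈
        ({bit (r * s + l), fun x => bit (r * s + l) x * v x} : Set (X → ℝ)),
        f ∈ affSpan ((⋃ l ∈ Finset.range r,
          ({bit (r * s + l), fun x => bit (r * s + l) x * v x} : Set (X → ℝ))) ∪ T) :=
      fun l hl f hf => mem_affSpan (Or.inl (Set.mem_biUnion hl hf))
    rintro f (rfl | rfl | rfl | rfl | rfl | rfl)
    · exact mem_affSpan (Or.inr (by simp [T]))
    · exact mem_affSpan (Or.inr (by simp [T]))
    · exact mem_affSpan (Or.inr (by simp [T]))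
    · exact mem_affSpan (Or.inr (by simp [T]))
    · simp only [mul_add_one, Finset.sum_range_add]
      exact add_mem_affSpan (mem_affSpan (Or.inr (by simp [T, bit])))
        (sum_mem_affSpan fun l hl => mul_mem_affSpan _ (hmem l hl _ (Or.inl rfl)))
    · simp only [mul_add_one, Finset.sum_range_add]
      exact add_mem_affSpan (mem_affSpan (Or.inr (by simp [T, bit])))
        (sum_mem_affSpan fun l hl => mul_mem_affSpan _ (hmem l hl _ (Or.inr rfl)))

/-- The product of a network function with a quantized coefficient that is stored in a table. -/
theorem reach_coeff_mul {N L : ℕ} (hN : 2 ≤ N) (p u b : X → ℕ) (hp : ∀ x, p x < N)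
    (hu : ∀ x, u x < N * L) (hb : ∀ x, b x < L) {m : ℕ} (net : ReLUNetwork m 1)
    {K : ℝ} (hK : ∀ y, |net.eval y 0| ≤ K) (y : Fin m → X → ℝ) {A : Set (X → ℝ)}
    (hpA : (fun x => (p x : ℝ)) ∈ affSpan A) (huA : (fun x => (u x : ℝ)) ∈ affSpan A)
    (hbA : (fun x => (b x : ℝ)) ∈ affSpan A) (hyA : ∀ i, y i ∈ affSpan A)
    (r s : ℕ) (τ : ℕ → ℕ → ℕ → ℕ) (hτ : ∀ a b c, τ a b c < 2 ^ (r * s)) (M : ℝ) :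
    ReLUReach (max (net.width + 3) (r * (2 * N + 4) + 6)) (net.depth - 1 + s * (4 * L + 2)) A
      {fun x => M * (2 * (τ (p x) (u x) (b x)) / 2 ^ (r * s) - 1) *
        net.eval (fun i => y i x) 0} := by
  classical
  -- Adding `K` gives `0 ≤ v ≤ 2K`, as carrying and bit multiplication require.
  let v : X → ℝ := fun x => net.eval (fun i => y i x) 0 + K
  let T : Finset (X → ℝ) := {fun x => (p x : ℝ), fun x => (u x : ℝ), fun x => (b x : ℝ)}
  have R₁ : ReLUReach (net.width + 3) (net.depth - 1) A
      {fun x => (p x : ℝ), fun x => (u x : ℝ), fun x => (b x : ℝ), v} := by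
    refine (((ReLUReach.of_network net A hyA).union_carry T (fun f hf => ?_)
      (fun f hf => ?_)).mono_width (Nat.add_le_add_left Finset.card_le_three _)).mono_right ?_
    · simp only [T, Finset.mem_insert, Finset.mem_singleton] at hf
      rcases hf with rfl | rfl | rfl <;> assumption
    · simp only [T, Finset.mem_insert, Finset.mem_singleton] at hf
      rcases hf with rfl | rfl | rfl <;> exact fun x => Nat.cast_nonneg _
    · rintro f (rfl | rfl | rfl | rfl)
      · exact mem_affSpan (Or.inr (by simp [T]))
      · exact mem_affSpan (Or.inr (by simp [T]))
      · exact mem_affSpan (Or.inr (by simp [T]))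
      · exact add_mem_affSpan (mem_affSpan (Or.inl ⟨0, rfl⟩)) (const_mem_affSpan _ _)
  have R₂ := reach_bit_sums hN p u b hp hu hb v (K := K + K)
    (fun x => by
      have := (abs_le.1 (hK fun i => y i x)).1
      simp only [v]; linarith)
    (fun x => by
      have := (abs_le.1 (hK fun i => y i x)).2
      simp only [v]; linarith)
    (fun l a b c => (τ a b c).testBit l) r s
  have hsum : ∀ x, ∑ l ∈ Finset.range (r * s),
      2 ^ l * ((((τ (p x) (u x) (b x)).testBit l).toNat : ℕ) : ℝ) = τ (p x) (u x) (b x) := by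
    intro x
    have h1 := sum_two_pow_mul_testBit (τ (p x) (u x) (b x)) (r * s)
    rw [Nat.mod_eq_of_lt (hτ _ _ _)] at h1
    exact_mod_cast h1
  refine ((R₁.mono_width (le_max_left _ _)).trans (R₂.mono_width (le_max_right _ _))).mono_right ?_
  rintro _ rfl
  simp only [← mul_assoc, ← Finset.sum_mul, hsum]
  have heq : (fun x => M * (2 * (τ (p x) (u x) (b x)) / 2 ^ (r * s) - 1) *
      net.eval (fun i => y i x) 0) = fun x => M * (2 / 2 ^ (r * s)) * (τ (p x) (u x) (b x) * v x)
        - M * (2 / 2 ^ (r * s)) * K * τ (p x) (u x) (b x) - M * (v x - K) := by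
    ext x
    simp only [v]
    ring
  rw [heq]
  exact sub_mem_affSpan (sub_mem_affSpan (mul_mem_affSpan _ (mem_affSpan (by simp)))
    (mul_mem_affSpan _ (mem_affSpan (by simp))))
    (mul_mem_affSpan _ (sub_mem_affSpan (mem_affSpan (by simp)) (const_mem_affSpan _ _)))

end BitSums

/-! ### Locating the dyadic cube -/

section Cube

/-- The index `⌊2^j x_i⌋` of the dyadic interval that contains `x_i`. -/
noncomputable def cellCoord (j : ℕ) {d : ℕ} (x : Fin d → ℝ) (i : Fin d) : ℕ := ⌊2 ^ j * x i⌋₊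

/-- The position `2^j x_i - ⌊2^j x_i⌋` of `x_i` in its dyadic interval. -/
noncomputable def cellFract (j : ℕ) {d : ℕ} (x : Fin d → ℝ) (i : Fin d) : ℝ :=
  2 ^ j * x i - cellCoord j x i

/-- The number of the dyadic cube that contains `x`. -/
noncomputable def cellIndex (j : ℕ) {d : ℕ} (x : Fin d → ℝ) : ℕ :=
  ∑ i, cellCoord j x i * (2 ^ j) ^ (i : ℕ)

variable {d j : ℕ} {δ : ℝ} {x : Fin d → ℝ}

theorem cellCoord_lt (hx : x ∈ goodCube j δ d) (i : Fin d) : cellCoord j x i < 2 ^ j := by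
  have h := (hx i).1
  rw [cellCoord, Nat.floor_lt (mul_nonneg (by positivity) h.1)]
  have := mul_lt_mul_of_pos_left h.2 (by positivity : (0 : ℝ) < 2 ^ j)
  push_cast
  linarith

theorem cellFract_mem (hx : x ∈ goodCube j δ d) (i : Fin d) :
    cellFract j x i ∈ Set.Ico (0 : ℝ) 1 := by
  have h := (hx i).1
  have h1 := Nat.floor_le (mul_nonneg (by positivity : (0 : ℝ) ≤ 2 ^ j) h.1)
  have h2 := Nat.lt_floor_add_one (2 ^ j * x i)
  simp only [cellFract, cellCoord]
  exact ⟨by linarith, by linarith⟩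

/-- The coordinates are the base `2^j` digits of the cube number, so any function of the cube is a
function of its number. The value 0 beyond the range is never read on the good cube. -/
theorem exists_cellIndex_decode (d j : ℕ) (δ : ℝ) :
    ∃ D : ℕ → Fin d → ℕ, ∀ x ∈ goodCube j δ d, D (cellIndex j x) = cellCoord j x := by
  classical
  refine ⟨fun n i => if h : n < (2 ^ j) ^ d then (finFunctionFinEquiv.symm ⟨n, h⟩ i : Fin _) else 0,
    fun x hx => ?_⟩
  have h1 : (finFunctionFinEquiv fun i => (⟨cellCoord j x i, cellCoord_lt hx i⟩ : Fin (2 ^ j)) :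
      Fin _).val = cellIndex j x := by
    rw [finFunctionFinEquiv_apply]
    rfl
  ext i
  rw [← h1]
  refine (dif_pos (Fin.is_lt _)).trans ?_
  rw [Fin.eta, Equiv.symm_apply_apply]

theorem cellIndex_lt (hx : x ∈ goodCube j δ d) : cellIndex j x < 2 ^ (d * j) := by
  have h1 : (finFunctionFinEquiv fun i => (⟨cellCoord j x i, cellCoord_lt hx i⟩ : Fin (2 ^ j)) :
      Fin _).val = cellIndex j x := by
    rw [finFunctionFinEquiv_apply]
    rfl
  rw [← h1, mul_comm, pow_mul]
  exact Fin.is_lt _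

/-- The fractional part is reduction modulo 1; scaling by `2^j` turns the excluded intervals into
gaps of length `2^j * δ` below the integers. -/
theorem reach_cellFract (hδ : 0 < δ) (r c : ℕ) (hc : j ≤ c * r) (i : Fin d) :
    ReLUReach (X := goodCube j δ d) (2 ^ (r + 1)) c {fun x => 2 ^ j * x.1 i}
      {fun x => cellFract j x.1 i} := by
  have h := reach_mod (X := goodCube j δ d) r (η := 2 ^ j * δ) (by positivity) one_pos c j hc
    (fun x => 2 ^ j * x.1 i) (fun x => mul_nonneg (by positivity) (x.2 i).1.1)
    (fun x => by
      have := mul_lt_mul_of_pos_left (x.2 i).1.2 (by positivity : (0 : ℝ) < 2 ^ j)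
      push_cast
      linarith)
    (fun x T hT1 hT2 => by
      have h1 := (x.2 i).2
      simp only [Set.mem_iUnion, not_exists] at h1
      have h2 := h1 T ⟨hT1, by omega⟩
      simp only [Set.mem_Ioo, not_and_or, not_lt] at h2
      have hp : (0 : ℝ) < 2 ^ j := by positivity
      rcases h2 with h2 | h2
      · right
        have h3 := mul_le_mul_of_nonneg_left h2 hp.le
        rwa [mul_sub, mul_div_cancel₀ _ hp.ne'] at h3
      · left
        have h3 := mul_le_mul_of_nonneg_left h2 hp.le
        rwa [mul_div_cancel₀ _ hp.ne'] at h3)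
  simpa [cellFract, cellCoord] using h

theorem reach_mod_nat {X : Type*} (r : ℕ) {k : ℕ} (hk : 0 < k) (c n : ℕ) (hn : n ≤ c * r)
    (z : X → ℕ) (hz : ∀ x, z x < k * 2 ^ n) :
    ReLUReach (2 ^ (r + 1)) c {fun x => (z x : ℝ)} {fun x => ((z x % k : ℕ) : ℝ)} := by
  have h := reach_mod r one_pos hk c n hn (fun x => (z x : ℝ)) (fun x => Nat.cast_nonneg _)
    (fun x => by exact_mod_cast hz x) (fun x T _ _ => by
      rcases Nat.lt_or_ge (z x) T with h | h
      · right
        rw [le_sub_iff_add_le]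
        exact_mod_cast h
      · left
        exact_mod_cast h)
  have heq : (fun x => (z x : ℝ) - k * ⌊(z x : ℝ) / k⌋₊) = fun x => ((z x % k : ℕ) : ℝ) := by
    ext x
    rw [Nat.floor_div_natCast, Nat.floor_natCast, sub_eq_iff_eq_add]
    exact_mod_cast (Nat.mod_add_div (z x) k).symm
  rwa [heq] at h

/-- The integer parts, hence the cube number, are affine in the `2^j x_i` and their fractional
parts. Two reductions of the number, modulo `2^r * 2^s * 2^s` and modulo `2^s`, then determine the
three parts as scaled differences. Each of the two phases takes `2 * s + 2` layers. -/
theorem reach_cell (hd : 1 ≤ d) (hδ : 0 < δ) {r s : ℕ} (hr : 1 ≤ r)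
    (hrs : d * j ≤ 2 * (s + r)) :
    ReLUReach (X := goodCube j δ d) (7 * d * 2 ^ r + 4 * d) (2 * (2 * s + 2))
      (Set.range fun i x => x.1 i)
      ({fun x => ((cellIndex j x.1 / (2 ^ r * 2 ^ s * 2 ^ s) : ℕ) : ℝ),
        fun x => ((cellIndex j x.1 % (2 ^ r * 2 ^ s * 2 ^ s) / 2 ^ s : ℕ) : ℝ),
        fun x => ((cellIndex j x.1 % 2 ^ s : ℕ) : ℝ)} ∪
        Set.range fun i x => cellFract j x.1 i) := by
  classical
  have hr2 : 2 ≤ 2 ^ r := by simpa using Nat.pow_le_pow_right (n := 2) (by norm_num) hr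
  -- Since `1 ≤ d` and `1 ≤ r`, one has `j ≤ d * j ≤ 2 * s + 2 * r ≤ (2 * s + 2) * r`.
  have hj : j ≤ (2 * s + 2) * r := by nlinarith
  let Z : Finset (goodCube j δ d → ℝ) := Finset.univ.image fun i x => 2 ^ j * x.1 i
  let Y : Finset (goodCube j δ d → ℝ) := Finset.univ.image fun i x => cellFract j x.1 i
  have hZc : Z.card ≤ d := Finset.card_image_le.trans (by simp)
  have hYc : Y.card ≤ d := Finset.card_image_le.trans (by simp)
  have hY : (Y : Set (goodCube j δ d → ℝ)) = Set.range fun i x => cellFract j x.1 i := by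
    simp [Y]
  have hz : ∀ i, (fun x : goodCube j δ d => 2 ^ j * x.1 i) ∈
      affSpan (Set.range fun (i : Fin d) (x : goodCube j δ d) => x.1 i) :=
    fun i => mul_mem_affSpan _ (mem_affSpan ⟨i, rfl⟩)
  have R₁ : ReLUReach (X := goodCube j δ d) (7 * d * 2 ^ r + 4 * d) (2 * s + 2)
      (Set.range fun i x => x.1 i) ((Y : Set _) ∪ Z) := by
    have h1 := (ReLUReach.iUnion Finset.univ fun (i : Fin d) _ =>
      (reach_cellFract (d := d) hδ r (2 * s + 2) hj i).mono_left (by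
        rintro _ rfl
        exact hz i)).union_carry Z (fun f hf => by
          obtain ⟨i, -, rfl⟩ := Finset.mem_image.1 hf
          exact hz i) (fun f hf => by
          obtain ⟨i, -, rfl⟩ := Finset.mem_image.1 hf
          exact fun x => mul_nonneg (by positivity) (x.2 i).1.1)
    refine (h1.mono_width ?_).mono_right ?_
    · rw [Finset.card_univ, Fintype.card_fin, pow_succ]
      nlinarith
    · rintro f (hf | hf)
      · obtain ⟨i, -, rfl⟩ := Finset.mem_image.1 hf
        exact mem_affSpan (Or.inl (Set.mem_biUnion (Finset.mem_univ i) rfl))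
      · exact mem_affSpan (Or.inr hf)
  have hI : (fun x : goodCube j δ d => (cellIndex j x.1 : ℝ)) ∈ affSpan ((Y : Set _) ∪ Z) := by
    have heq : (fun x : goodCube j δ d => (cellIndex j x.1 : ℝ)) =
        fun x => ∑ i : Fin d, (2 ^ j) ^ (i : ℕ) * (2 ^ j * x.1 i - cellFract j x.1 i) := by
      ext x
      rw [cellIndex]
      push_cast
      refine Finset.sum_congr rfl fun i _ => ?_
      rw [cellFract]
      ring
    rw [heq]
    exact sum_mem_affSpan fun i _ => mul_mem_affSpan _ (sub_mem_affSpan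
      (mem_affSpan (Or.inr (Finset.mem_image_of_mem _ (Finset.mem_univ i))))
      (mem_affSpan (Or.inl (Finset.mem_image_of_mem _ (Finset.mem_univ i)))))
  let I : goodCube j δ d → ℕ := fun x => cellIndex j x.1
  have hIlt : ∀ x, I x < 2 ^ r * 2 ^ s * 2 ^ s * 2 ^ r := by
    intro x
    have h1 : (2 : ℕ) ^ r * 2 ^ s * 2 ^ s * 2 ^ r = 2 ^ (2 * (s + r)) := by ring
    rw [h1]
    exact (cellIndex_lt x.2).trans_le (Nat.pow_le_pow_right (by norm_num) hrs)
  have R₂ := reach_mod_nat r (k := 2 ^ r * 2 ^ s * 2 ^ s) (by positivity) (2 * s + 2) r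
    (by nlinarith) I hIlt
  have R₃ := reach_mod_nat r (k := 2 ^ s) (by positivity) (2 * s + 2) (r + s + r)
    (by nlinarith) I (fun x => by
      have h1 : (2 : ℕ) ^ s * 2 ^ (r + s + r) = 2 ^ r * 2 ^ s * 2 ^ s * 2 ^ r := by ring
      rw [h1]
      exact hIlt x)
  let TI : Finset (goodCube j δ d → ℝ) := {fun x => (I x : ℝ)}
  have hA : ({fun x => (I x : ℝ)} : Set (goodCube j δ d → ℝ)) ⊆
      affSpan ((Y : Set (goodCube j δ d → ℝ)) ∪ Z) := by
    rintro _ rfl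
    exact hI
  have R₄ := ((((R₂.mono_left hA).union_same (R₃.mono_left hA)).union_carry TI (fun f hf => by
      rw [Finset.mem_singleton.1 hf]
      exact hI) (fun f hf => by
      rw [Finset.mem_singleton.1 hf]
      exact fun x => Nat.cast_nonneg _)).union_carry Y (fun f hf => mem_affSpan (Or.inl hf))
      (fun f hf => by
        obtain ⟨i, -, rfl⟩ := Finset.mem_image.1 hf
        exact fun x => (cellFract_mem x.2 i).1)).mono_width (W' := 7 * d * 2 ^ r + 4 * d) (by
      have : TI.card = 1 := Finset.card_singleton _
      rw [this, pow_succ]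
      nlinarith)
  have hlen : 2 * (2 * s + 2) = 2 * s + 2 + (2 * s + 2) := by ring
  rw [hlen]
  refine (R₁.trans R₄).mono_right ?_
  rw [hY]
  set Bf := ({fun x => ((I x % (2 ^ r * 2 ^ s * 2 ^ s) : ℕ) : ℝ)} ∪
    {fun x => ((I x % 2 ^ s : ℕ) : ℝ)} ∪ (TI : Set (goodCube j δ d → ℝ)) ∪
    Set.range fun i x => cellFract j x.1 i)
  have h1 : (fun x => ((I x % (2 ^ r * 2 ^ s * 2 ^ s) : ℕ) : ℝ)) ∈ affSpan Bf :=
    mem_affSpan (Or.inl (Or.inl (Or.inl rfl)))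
  have h2 : (fun x => ((I x % 2 ^ s : ℕ) : ℝ)) ∈ affSpan Bf :=
    mem_affSpan (Or.inl (Or.inl (Or.inr rfl)))
  have h3 : (fun x => (I x : ℝ)) ∈ affSpan Bf := mem_affSpan (Or.inl (Or.inr (by simp [TI])))
  rintro f ((rfl | rfl | rfl) | hf)
  · have heq : (fun x : goodCube j δ d => ((cellIndex j x.1 / (2 ^ r * 2 ^ s * 2 ^ s) : ℕ) : ℝ)) =
        fun x => ((2 ^ r * 2 ^ s * 2 ^ s : ℕ) : ℝ)⁻¹ *
          ((I x : ℝ) - ((I x % (2 ^ r * 2 ^ s * 2 ^ s) : ℕ) : ℝ)) := by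
      ext x
      rw [eq_inv_mul_iff_mul_eq₀ (by positivity), eq_sub_iff_add_eq]
      exact_mod_cast Nat.div_add_mod (I x) (2 ^ r * 2 ^ s * 2 ^ s)
    rw [heq]
    exact mul_mem_affSpan _ (sub_mem_affSpan h3 h1)
  · have heq : (fun x : goodCube j δ d =>
        ((cellIndex j x.1 % (2 ^ r * 2 ^ s * 2 ^ s) / 2 ^ s : ℕ) : ℝ)) =
        fun x => ((2 ^ s : ℕ) : ℝ)⁻¹ *
          (((I x % (2 ^ r * 2 ^ s * 2 ^ s) : ℕ) : ℝ) - ((I x % 2 ^ s : ℕ) : ℝ)) := by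
      ext x
      rw [eq_inv_mul_iff_mul_eq₀ (by positivity), eq_sub_iff_add_eq]
      have h4 := Nat.div_add_mod (I x % (2 ^ r * 2 ^ s * 2 ^ s)) (2 ^ s)
      rw [Nat.mod_mod_of_dvd _ (Dvd.intro_left _ rfl)] at h4
      exact_mod_cast h4
    rw [heq]
    exact mul_mem_affSpan _ (sub_mem_affSpan h1 h2)
  · exact h2
  · exact mem_affSpan (Or.inr hf)

end Cube

/-! ### Pointwise bounds, quantization and active shifts -/

section Approximation

/-- The set where the bound fails is open and null, hence empty. -/
theorem Continuous.abs_le_of_eLpNorm_top_le {d : ℕ} {f : (Fin d → ℝ) → ℝ} (hf : Continuous f)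
    {C : ℝ≥0∞} (hC : C ≠ ∞) (h : eLpNorm f ∞ volume ≤ C) (x : Fin d → ℝ) : |f x| ≤ C.toReal := by
  by_contra! hx
  have hopen : IsOpen {y | C.toReal < |f y|} := isOpen_lt continuous_const hf.abs
  refine (hopen.measure_pos volume ⟨x, hx⟩).ne' ?_
  have h1 : ∀ᵐ y ∂(volume : Measure (Fin d → ℝ)), ‖f y‖ₑ ≤ C := by
    filter_upwards [ae_le_eLpNormEssSup (f := f) (μ := volume)] with y hy
    rw [← eLpNorm_exponent_top] at hy
    exact hy.trans h
  refine measure_mono_null (fun y hy => ?_) (ae_iff.1 h1)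
  intro hy'
  have h2 := ENNReal.toReal_mono hC hy'
  rw [toReal_enorm, Real.norm_eq_abs] at h2
  exact absurd h2 (not_le.2 hy)

theorem continuous_relu : Continuous relu := continuous_const.max continuous_id

theorem ReLUNetwork.continuous_eval {m k : ℕ} (net : ReLUNetwork m k) : Continuous net.eval := by
  induction net with
  | output A b => exact (Continuous.matrix_mulVec continuous_const continuous_id).add continuous_const
  | hidden A b rest ih =>
    refine ih.comp (continuous_pi fun i => continuous_relu.comp ((continuous_apply i).comp ?_))
    exact (Continuous.matrix_mulVec continuous_const continuous_id).add continuous_const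

/-- Rounding down to a grid of `2^B` points in `[-M, M)` of spacing `2 * M / 2^B`; strictness of
`|a| < M` keeps the index below `2^B`. -/
theorem exists_nat_quantize {a M : ℝ} (h : |a| < M) (B : ℕ) :
    ∃ t : ℕ, t < 2 ^ B ∧ |a - M * (2 * t / 2 ^ B - 1)| ≤ 2 * M / 2 ^ B := by
  have hM : 0 < M := (abs_nonneg a).trans_lt h
  obtain ⟨h1, h2⟩ := abs_lt.1 h
  have hp : (0 : ℝ) < 2 ^ B := by positivity
  have h0 : 0 ≤ 2 ^ B * ((a + M) / (2 * M)) :=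
    mul_nonneg hp.le (div_nonneg (by linarith) (by linarith))
  refine ⟨⌊2 ^ B * ((a + M) / (2 * M))⌋₊, ?_, ?_⟩
  · rw [Nat.floor_lt h0]
    have : (a + M) / (2 * M) < 1 := by rw [div_lt_one (by linarith)]; linarith
    push_cast
    nlinarith
  · have h3 := Nat.floor_le h0
    have h4 := (Nat.lt_floor_add_one (2 ^ B * ((a + M) / (2 * M)))).le
    set t : ℝ := (⌊2 ^ B * ((a + M) / (2 * M))⌋₊ : ℝ)
    have h5 : a - M * (2 * t / 2 ^ B - 1) =
        2 * M / 2 ^ B * (2 ^ B * ((a + M) / (2 * M)) - t) := by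
      field_simp
      ring
    rw [h5, abs_mul, abs_of_pos (by positivity : 0 < 2 * M / 2 ^ B)]
    refine mul_le_of_le_one_right (by positivity) ?_
    rw [abs_le]
    constructor <;> linarith

theorem two_div_two_pow_le {ε : ℝ} (hε : 0 < ε) {B : ℕ}
    (hB : ⌈Real.logb 2 (1 / ε)⌉₊ + 1 ≤ B) : 2 / 2 ^ B ≤ ε := by
  obtain ⟨n, rfl⟩ : ∃ n, B = n + 1 := ⟨B - 1, by omega⟩
  have h1 : Real.logb 2 (1 / ε) ≤ n :=
    (Nat.le_ceil _).trans (by exact_mod_cast (by omega : ⌈Real.logb 2 (1 / ε)⌉₊ ≤ n))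
  rw [Real.logb_le_iff_le_rpow (by norm_num) (by positivity), Real.rpow_natCast,
    div_le_iff₀ hε] at h1
  rw [div_le_iff₀ (by positivity), pow_succ]
  linarith

/-- On the good cube only the active shifts contribute to a function of the shift-invariant
space. -/
theorem sum_shift_eq_sum_active {d j : ℕ} {δ : ℝ} {φ : (Fin d → ℝ) → ℝ}
    (hφ : HasCompactSupport φ) (c : (Fin d → ℤ) →₀ ℝ) {x : Fin d → ℝ} (hx : x ∈ goodCube j δ d) :
    (c.sum fun n a => a * φ (fun i => 2 ^ j * x i - (n i : ℝ))) =
      ∑ k ∈ (activeShifts_finite hφ).toFinset, c (fun i => cellCoord j x i + k i) *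
        φ (fun i => cellFract j x i - (k i : ℝ)) := by
  classical
  let e : (Fin d → ℤ) → Fin d → ℤ := fun k i => cellCoord j x i + k i
  have he : Function.Injective e := fun k l h => funext fun i => by
    simpa [e] using congrFun h i
  have harg : ∀ k : Fin d → ℤ, (fun i => 2 ^ j * x i - ((e k i : ℤ) : ℝ)) =
      fun i => cellFract j x i - (k i : ℝ) := by
    intro k
    ext i
    simp only [e, cellFract]
    push_cast
    ring
  have h1 : ∑ k ∈ (activeShifts_finite hφ).toFinset, c (fun i => cellCoord j x i + k i) *
        φ (fun i => cellFract j x i - (k i : ℝ)) =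
      ∑ n ∈ (activeShifts_finite hφ).toFinset.image e,
        c n * φ (fun i => 2 ^ j * x i - (n i : ℝ)) := by
    rw [Finset.sum_image he.injOn]
    exact Finset.sum_congr rfl fun k _ => by rw [harg]
  -- Both sums are extended by zero terms to the union of their index sets. Outside the support the
  -- coefficient vanishes; outside the translated active shifts `φ` vanishes, because the fractional
  -- part lies in `[0,1)^d`.
  rw [h1, Finsupp.sum, Finset.sum_subset Finset.subset_union_left (s₂ := c.support ∪
    (activeShifts_finite hφ).toFinset.image e) (fun n _ hn => ?_)]
  · refine (Finset.sum_subset Finset.subset_union_right fun n _ hn => ?_).symm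
    refine mul_eq_zero_of_right _ (by_contra fun hne => hn (Finset.mem_image.2
      ⟨fun i => n i - cellCoord j x i, ?_, ?_⟩))
    · rw [Set.Finite.mem_toFinset]
      refine ⟨cellFract j x, cellFract_mem hx, ?_⟩
      rw [← harg]
      simpa [e] using hne
    · ext i
      simp [e]
  · rw [Finsupp.notMem_support_iff.1 hn, zero_mul]

theorem abs_mul_sub_mul_le {a a' y y' M S ε : ℝ} (hM : 0 ≤ M) (ha : |a - a'| ≤ M * ε)
    (ha' : |a'| ≤ M) (hy : |y| ≤ S) (hy' : |y - y'| ≤ ε * S) :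
    |a * y - a' * y'| ≤ 2 * M * S * ε := by
  have h1 : a * y - a' * y' = (a - a') * y + a' * (y - y') := by ring
  rw [h1]
  refine (abs_add_le _ _).trans ?_
  rw [abs_mul, abs_mul]
  have h2 := mul_le_mul ha hy (abs_nonneg _) ((abs_nonneg _).trans ha)
  have h3 := mul_le_mul ha' hy' (abs_nonneg _) hM
  linarith

end Approximation

/-! ### Assembly of the network -/

theorem mainTheorem2 (d j : ℕ) (hd : 1 ≤ d) (hj : 1 ≤ j)
    (δ ε M : ℝ) (hδ : 0 < δ) (hδj : δ < 1 / 2 ^ j) (hε : 0 < ε) (hε1 : ε < 1) (hM : 0 < M)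
    (φ : (Fin d → ℝ) → ℝ) (hφ : Continuous φ) (hφc : HasCompactSupport φ)
    (Nφ Lφ : ℕ)
    (hφ₀ : ∃ φ₀ ∈ reluNN d Nφ Lφ,
      eLpNorm (fun x => φ x - φ₀ x) ∞ volume ≤ ENNReal.ofReal ε * eLpNorm φ ∞ volume)
    (g : (Fin d → ℝ) → ℝ) (hg : g ∈ shiftInvariantSpace φ j M)
    (r s r' s' : ℕ) (hr : 1 ≤ r) (hs : 1 ≤ s) (hr' : 1 ≤ r') (hs' : 1 ≤ s')
    (hrs : d * j ≤ 2 * (s + r)) (hrs' : ⌈Real.logb 2 (1 / ε)⌉₊ + 1 ≤ r' * s') :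
    ∃ f ∈ reluNN d (shiftCount φ * (max (7 * d * r' * 2 ^ r) Nφ + 4 * d))
        (14 * s' * 2 ^ s + Lφ),
      ∀ x ∈ goodCube j δ d,
        |g x - f x| ≤ 3 * (shiftCount φ : ℝ) * M * (eLpNorm φ ∞ volume).toReal * ε := by
  classical
  obtain ⟨φ₀, ⟨net, hnet2, hnetL, hnetN, hφ₀net⟩, hφφ₀⟩ := hφ₀
  obtain ⟨c, hcM, hgc⟩ := hg
  have hfin : eLpNorm φ ∞ volume ≠ ∞ := (hφ.memLp_of_hasCompactSupport hφc).eLpNorm_lt_top.ne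
  obtain ⟨S, hS⟩ : ∃ S, S = (eLpNorm φ ∞ volume).toReal := ⟨_, rfl⟩
  have hS0 : 0 ≤ S := hS ▸ ENNReal.toReal_nonneg
  have hφS : ∀ y, |φ y| ≤ S := fun y => hS ▸ hφ.abs_le_of_eLpNorm_top_le hfin le_rfl y
  have hφ₀c : Continuous φ₀ := by
    rw [show φ₀ = fun x => net.eval x 0 from funext hφ₀net]
    exact (continuous_apply 0).comp net.continuous_eval
  have hdiff : ∀ y, |φ y - φ₀ y| ≤ ε * S := by
    intro y
    have h1 := (hφ.sub hφ₀c).abs_le_of_eLpNorm_top_le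
      (ENNReal.mul_ne_top ENNReal.ofReal_ne_top hfin) hφφ₀ y
    rwa [ENNReal.toReal_mul, ENNReal.toReal_ofReal hε.le, ← hS] at h1
  have hK : ∀ y, |net.eval y 0| ≤ S + ε * S := by
    intro y
    rw [← hφ₀net]
    have h1 := abs_sub_abs_le_abs_sub (φ₀ y) (φ y)
    rw [abs_sub_comm] at h1
    linarith [hφS y, hdiff y]
  obtain ⟨D, hD⟩ := exists_cellIndex_decode d j δ
  choose t ht htc using fun n => exists_nat_quantize (hcM n) (r' * s')
  let Z := (activeShifts_finite hφc).toFinset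
  have hZ : Z.card = shiftCount φ := (Set.ncard_eq_toFinset_card _ _).symm
  let Q := goodCube j δ d
  let m := 2 ^ r * 2 ^ s * 2 ^ s
  let p : Q → ℕ := fun x => cellIndex j x.1 / m
  let u : Q → ℕ := fun x => cellIndex j x.1 % m / 2 ^ s
  let b : Q → ℕ := fun x => cellIndex j x.1 % 2 ^ s
  -- The cube number is recomposed from its three parts, decoded to the corner and shifted by `k`;
  -- the entry is the rounded coefficient there.
  let τ : (Fin d → ℤ) → ℕ → ℕ → ℕ → ℕ := fun k q w l =>
    t fun i => D (m * q + (2 ^ s * w + l)) i + k i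
  have hN2 : 2 ≤ 2 ^ r := by simpa using Nat.pow_le_pow_right (n := 2) (by norm_num) hr
  have hp : ∀ x, p x < 2 ^ r := fun x => by
    refine Nat.div_lt_of_lt_mul ((cellIndex_lt x.2).trans_le ?_)
    have h1 : m * 2 ^ r = 2 ^ (2 * (s + r)) := by simp only [m]; ring
    rw [h1]
    exact Nat.pow_le_pow_right (by norm_num) hrs
  have hu : ∀ x, u x < 2 ^ r * 2 ^ s := fun x => by
    refine Nat.div_lt_of_lt_mul ((Nat.mod_lt _ (by positivity)).trans_eq ?_)
    simp only [m]
    ring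
  have hb : ∀ x, b x < 2 ^ s := fun x => Nat.mod_lt _ (by positivity)
  have hτ : ∀ (k : Fin d → ℤ) (x : Q), τ k (p x) (u x) (b x) =
      t fun i => cellCoord j x.1 i + k i := by
    intro k x
    have h1 : 2 ^ s * u x + b x = cellIndex j x.1 % m := by
      have h2 := Nat.div_add_mod (cellIndex j x.1 % m) (2 ^ s)
      rwa [Nat.mod_mod_of_dvd _ (Dvd.intro_left _ rfl)] at h2
    simp only [τ]
    rw [h1, Nat.div_add_mod, hD _ x.2]
  let W := max (7 * d * r' * 2 ^ r) Nφ + 4 * d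
  let F : (Fin d → ℤ) → Q → ℝ := fun k x =>
    M * (2 * (τ k (p x) (u x) (b x)) / 2 ^ (r' * s') - 1) *
      net.eval (fun i => cellFract j x.1 i - k i) 0
  have R : ∀ k ∈ Z, ReLUReach W (2 * (2 * s + 2) + (net.depth - 1 + s' * (4 * 2 ^ s + 2)))
      (Set.range fun (i : Fin d) (x : Q) => x.1 i) {F k} := by
    intro k _
    have hle : d * 2 ^ r ≤ d * r' * 2 ^ r := by
      rw [mul_right_comm]
      exact Nat.le_mul_of_pos_right _ hr'
    refine ((reach_cell (δ := δ) hd hδ hr hrs).mono_width ?_).trans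
      ((reach_coeff_mul hN2 p u b hp hu hb net hK (fun i x => cellFract j x.1 i - k i)
        (mem_affSpan (Or.inl (Or.inl rfl))) (mem_affSpan (Or.inl (Or.inr (Or.inl rfl))))
        (mem_affSpan (Or.inl (Or.inr (Or.inr rfl))))
        (fun i => sub_mem_affSpan (mem_affSpan (Or.inr ⟨i, rfl⟩)) (const_mem_affSpan _ _))
        r' s' (τ k) (fun _ _ _ => ht _) M).mono_width ?_)
    · refine Nat.add_le_add_right (le_trans ?_ (le_max_left _ _)) _
      linarith
    · refine max_le ?_ ?_
      · have := le_max_right (7 * d * r' * 2 ^ r) Nφ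
        simp only [W]
        omega
      -- The width `2 * r' * 2^r + 4 * r' + 6` is at most `7 * r' * 2^r`, because `4 * r' ≤ 2 * r' *
      -- 2^r` and `6 ≤ 3 * r' * 2^r`.
      · have h1 := le_max_left (7 * d * r' * 2 ^ r) Nφ
        have h2 : r' * 2 ^ r ≤ d * r' * 2 ^ r :=
          Nat.mul_le_mul_right _ (Nat.le_mul_of_pos_left _ hd)
        have h3 : r' * 2 ≤ r' * 2 ^ r := Nat.mul_le_mul_left _ hN2
        simp only [W]
        linarith
  have RZ := ReLUReach.iUnion Z R
  rw [hZ] at RZ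
  obtain ⟨fnet, hdep, hwid, hev⟩ := RZ.exists_network rfl
    (f := fun (_ : Fin 1) x => ∑ k ∈ Z, F k x) (fun _ => sum_mem_affSpan fun k hk =>
      mem_affSpan (Set.mem_biUnion hk rfl))
  refine ⟨fun x => fnet.eval x 0, ⟨fnet, by omega, ?_, hwid, fun _ => rfl⟩, fun x hx => ?_⟩
  · rw [hdep]
    -- Locating the cube costs `4 * (s + 1) ≤ 4 * s' * 2^s` layers and the tables at most `5 * s' *
    -- 2^s`, well below the allowed `14 * s' * 2^s`.
    have h1 : s + 1 ≤ 2 ^ s := Nat.lt_two_pow_self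
    have h2 : 2 ^ s ≤ s' * 2 ^ s := Nat.le_mul_of_pos_left _ hs'
    have h3 : s' * 2 ≤ s' * 2 ^ s :=
      Nat.mul_le_mul_left _ (by simpa using Nat.pow_le_pow_right (n := 2) (by norm_num) hs)
    have h4 : s' * (4 * 2 ^ s + 2) = 4 * (s' * 2 ^ s) + s' * 2 := by ring
    have h5 : 14 * s' * 2 ^ s = 14 * (s' * 2 ^ s) := by ring
    rw [h4, h5]
    omega
  · have hfx : fnet.eval x 0 = ∑ k ∈ Z, F k ⟨x, hx⟩ := (hev ⟨x, hx⟩ 0).symm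
    beta_reduce
    rw [hfx, hgc, sum_shift_eq_sum_active hφc c hx, ← Finset.sum_sub_distrib, ← hS]
    refine (Finset.abs_sum_le_sum_abs _ _).trans ?_
    -- Half of the bound comes from rounding the coefficient, half from replacing `φ` by `φ₀`.
    -- Summation gives the constant 2, which is weakened to 3 at the end.
    have hterm : ∀ k ∈ Z, |c (fun i => cellCoord j x i + k i) *
        φ (fun i => cellFract j x i - (k i : ℝ)) - F k ⟨x, hx⟩| ≤ 2 * M * S * ε := by
      intro k _
      simp only [F]
      rw [hτ k ⟨x, hx⟩, ← hφ₀net]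
      refine abs_mul_sub_mul_le hM.le ((htc _).trans ?_) ?_ (hφS _) (hdiff _)
      · rw [mul_comm 2 M, mul_div_assoc]
        exact mul_le_mul_of_nonneg_left (two_div_two_pow_le hε hrs') hM.le
      · rw [abs_mul, abs_of_pos hM]
        refine mul_le_of_le_one_right hM.le ?_
        have h1 : ((t fun i => cellCoord j x i + k i : ℕ) : ℝ) ≤ 2 ^ (r' * s') := by
          exact_mod_cast (ht _).le
        have h2 : 2 * ((t fun i => cellCoord j x i + k i : ℕ) : ℝ) / 2 ^ (r' * s') ≤ 2 := by
          rw [div_le_iff₀ (by positivity)]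
          linarith
        have h3 : 0 ≤ 2 * ((t fun i => cellCoord j x i + k i : ℕ) : ℝ) / 2 ^ (r' * s') := by
          positivity
        rw [abs_le]
        constructor <;> linarith
    refine (Finset.sum_le_sum hterm).trans ?_
    rw [Finset.sum_const, hZ, nsmul_eq_mul]
    have h1 : 0 ≤ (shiftCount φ : ℝ) * (M * S * ε) := by positivity
    linarith
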